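/- For $n,m,\Delta\in\mathbb N$ let $\mathfrak F(m,n,\Delta)$ be the distribution of the random CNF $\varphi=C_1\wedge\dots\wedge C_m$ over $n$ Boolean variables whose clauses $C_1,\dots,C_m$ are independent and each uniformly distributed among the $\binom n\Delta 2^\Delta$ disjunctions of $\Delta$ literals over distinct variables. Let the variables be split between Alice and Bob uniformly at random, independently of $\varphi$: every subset $A\subseteq[n]$ is equally likely to be the set of Alice's variables, and Bob gets $B=[n]\setminus A$. In the problem $\mathrm{Search}_\varphi$, Alice gets $x\in\{0,1\}^A$, Bob gets $y\in\{0,1\}^B$, and they have to find an index $i\in[m]$ such that $C_i$ is falsified by the joint assignment $(x,y)$. A randomized (public-coin) protocol is a probability distribution over deterministic binary communication protocols; its communication is the largest depth of a protocol in its support. It solves $\mathrm{Search}_\varphi$ with success probability $p$ if for every $(x,y)$ that falsifies at least one clause (so for every $(x,y)$, if $\varphi$ is unsatisfiable) its output is, with probability at least $p$, the index of a falsified clause. **Theorem.** Let $c\ge 40$, $a>0$, $b$ and $p>0$ be real constants. There is $\kappa=\kappa(c,a,b,p)>0$ such that the following holds for all sequences of natural numbers $\Delta=\Delta(n)$ and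 $m=m(n)$ such that, for all large $n$, $|\Delta-c\log_2 n|\le 1$ and $a\,2^{\Delta}n\le m\le b\,2^{\Delta}n$ (that is, $\Delta=c\log n$ up to rounding, and $m=\Theta(2^\Delta n)$). For $\varphi\sim\mathfrak F(m,n,\Delta)$ and an independent uniformly random split of the variables, with probability tending to $1$ as $n\to\infty$, every randomized two-party protocol that solves $\mathrm{Search}_\varphi$ with success probability $p$ has communication at least $\kappa n$. If moreover $a>\ln 2$, then with probability tending to $1$ as $n\to\infty$, $\varphi$ is unsatisfiable and every such protocol has communication at least $\kappa n$. -/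

import Mathlib

open Filter Topology

namespace SearchCNF

/-- A `Δ`-clause over the variables `Fin n`: a set of exactly `Δ` distinct variables together with
a sign for each of them (`true` for the positive literal, `false` for the negated one).
There are `(n choose Δ) * 2 ^ Δ` of them. -/
abbrev Clause (n Δ : ℕ) : Type :=
  Σ s : {s : Finset (Fin n) // s.card = Δ}, ({j : Fin n // j ∈ s.1} → Bool)

/-- An assignment falsifies a clause (a disjunction of literals) if it falsifies each literal. -/
def Clause.Falsified {n Δ : ℕ} (C : Clause n Δ) (z : Fin n → Bool) : Prop :=
  ∀ j : {j : Fin n // j ∈ C.1.1}, z j.1 ≠ C.2 j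

/-- A `Δ`-CNF with `m` clauses (repetitions allowed) over `n` variables.  A uniformly random
element of this finite type consists of `m` independent uniformly random `Δ`-clauses. -/
abbrev Formula (m n Δ : ℕ) : Type := Fin m → Clause n Δ

/-- Every assignment falsifies some clause. -/
def Formula.Unsat {m n Δ : ℕ} (φ : Formula m n Δ) : Prop :=
  ∀ z : Fin n → Bool, ∃ i : Fin m, (φ i).Falsified z

/-- Deterministic two-party communication protocols with inputs in `X` (Alice) and `Y` (Bob) and
outputs in `Z`: binary trees; at an internal node its owner sends one bit, computed from the
owner's input, and the protocol continues in the corresponding subtree. -/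
inductive Protocol (X Y Z : Type) : Type
  | leaf (out : Z) : Protocol X Y Z
  | alice (bit : X → Bool) (next₀ next₁ : Protocol X Y Z) : Protocol X Y Z
  | bob (bit : Y → Bool) (next₀ next₁ : Protocol X Y Z) : Protocol X Y Z

/-- The output of the protocol on the input pair `(x, y)`. -/
def Protocol.eval {X Y Z : Type} : Protocol X Y Z → X → Y → Z
  | .leaf out, _, _ => out
  | .alice bit p₀ p₁, x, y => if bit x = true then p₁.eval x y else p₀.eval x y
  | .bob bit p₀ p₁, x, y => if bit y = true then p₁.eval x y else p₀.eval x y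

/-- The depth of the tree: the number of bits exchanged in the worst case. -/
def Protocol.depth {X Y Z : Type} : Protocol X Y Z → ℕ
  | .leaf _ => 0
  | .alice _ p₀ p₁ => max p₀.depth p₁.depth + 1
  | .bob _ p₀ p₁ => max p₀.depth p₁.depth + 1

/-- A (public-coin) randomized protocol: a probability distribution on deterministic protocols.
Private-coin protocols are a special case. -/
abbrev RandProtocol (X Y Z : Type) : Type := PMF (Protocol X Y Z)

/-- The communication is at most `d` bits for every outcome of the coins and every input. -/
def RandProtocol.CommAtMost {X Y Z : Type} (P : RandProtocol X Y Z) (d : ℕ) : Prop :=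
  ∀ T ∈ P.support, Protocol.depth T ≤ d

/-- Alice's inputs when she owns the variables in `A`. -/
abbrev AliceInput {n : ℕ} (A : Finset (Fin n)) : Type := {j : Fin n // j ∈ A} → Bool

/-- Bob's inputs when Alice owns the variables in `A`: he owns the remaining ones. -/
abbrev BobInput {n : ℕ} (A : Finset (Fin n)) : Type := {j : Fin n // j ∉ A} → Bool

/-- The joint assignment. -/
def join {n : ℕ} (A : Finset (Fin n)) (x : AliceInput A) (y : BobInput A) : Fin n → Bool :=
  fun j => if h : j ∈ A then x ⟨j, h⟩ else y ⟨j, h⟩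

/-- The randomized protocol `P` solves the search problem of `φ` (find the index of a clause
falsified by the joint assignment), for the split of the variables given by `A`, with success
probability at least `p` on every joint assignment that falsifies some clause.  If `φ` is
unsatisfiable, these are all assignments. -/
def SolvesSearch {m n Δ : ℕ} (φ : Formula m n Δ) (A : Finset (Fin n))
    (P : RandProtocol (AliceInput A) (BobInput A) (Fin m)) (p : ℝ) : Prop :=
  ∀ (x : AliceInput A) (y : BobInput A), (∃ i : Fin m, (φ i).Falsified (join A x y)) →
    ENNReal.ofReal p ≤ P.toOuterMeasure {T | (φ (T.eval x y)).Falsified (join A x y)}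

/-- The randomized communication complexity of the search problem of `φ` for the split `A`, with
success probability `p`, is at least `b`. -/
def RandCommAtLeast {m n Δ : ℕ} (φ : Formula m n Δ) (A : Finset (Fin n)) (p b : ℝ) : Prop :=
  ∀ (P : RandProtocol (AliceInput A) (BobInput A) (Fin m)) (d : ℕ),
    P.CommAtMost d → SolvesSearch φ A P p → b ≤ (d : ℝ)

open Classical in
/-- The probability of the event `E` for a uniformly random element of a (nonempty) finite type. -/
noncomputable def uniformProb (Ω : Type) [Fintype Ω] (E : Ω → Prop) : ℝ :=
  ((Finset.univ.filter E).card : ℝ) / (Fintype.card Ω : ℝ)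

end SearchCNF

/-! Clause `i` is falsified exactly on a product `F i ×ˢ G i` of two subcubes, one per player. A
leaf labelled `i` is therefore correct on at most a `τ ^ 2` fraction of its rectangle as long as `F
i` and `G i` have density at most `τ` in its sides. With `τ = n ^ (-3)` this holds at the root for
every clause with at least `Δ / 4` variables on each side, since `2 ^ (-Δ / 4) ≤ τ`. The few other
clauses are given up from the start: each is falsified by a `2 ^ (-Δ)` fraction of all inputs.

Communication can make clauses dense, but expansion allows this for few of them. Any `r ≈ n / (Δ * 2
^ 40)` clauses have nearly disjoint variable sets, so `r`-fold intersections of the cubes `F i` have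
codimension at least `r * Δ / 8`. By a factorial moment argument (`factorial_moment_bound`,
`Formula.Expands.card_denseIndices_le`), at most `M = 4 * r / τ` clauses are dense in any set of
density at least `σ = 2 ^ (-2 * κ * n)`.

An index that becomes dense at a node is given up there. It was sparse on both sides of the parent
rectangle, so the loss is at most `τ ^ 2` of that rectangle. Over all levels the loss is at most `2
* M * d * τ ^ 2 = O(1 / n)`, plus `2 ^ d * σ` for rectangles with a side too small for the moment
bound (`Protocol.card_correctOutside_le`). Averaging over the coins yields
`Formula.Expands.success_le`, which contradicts constant success when `d < κ * n`.

For random `φ` and split, expansion follows from a union bound, the scarcity of unbalanced clauses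
from a Chernoff bound, and the rest from the first moment of the number of satisfying assignments.
For `a > 0` at least half of all assignments falsify a clause, which suffices for the communication
bound; for `a > log 2` the first moment itself tends to zero. -/

namespace SearchCNF

open Finset

/-! ### Deterministic protocols: sparse indices along the protocol tree -/

section Protocols

variable {X Y Z : Type} [DecidableEq X] [DecidableEq Y] [DecidableEq Z]

/-- The inputs of `R` on which the output `z = g x y` is outside `U` and has `x ∈ F z`, `y ∈ G z`. -/
noncomputable def correctOutside (F : Z → Finset X) (G : Z → Finset Y) (g : X → Y → Z)
    (U : Finset Z) (R : Finset (X × Y)) : Finset (X × Y) :=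
  R.filter fun w => g w.1 w.2 ∉ U ∧ w.1 ∈ F (g w.1 w.2) ∧ w.2 ∈ G (g w.1 w.2)

theorem card_correctOutside_le_card (F : Z → Finset X) (G : Z → Finset Y) (g : X → Y → Z)
    (U : Finset Z) (X₀ : Finset X) (Y₀ : Finset Y) :
    ((correctOutside F G g U (X₀ ×ˢ Y₀)).card : ℝ) ≤ X₀.card * Y₀.card := by
  have h := Finset.card_filter_le (X₀ ×ˢ Y₀)
    (fun w => g w.1 w.2 ∉ U ∧ w.1 ∈ F (g w.1 w.2) ∧ w.2 ∈ G (g w.1 w.2))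
  rw [card_product] at h
  exact_mod_cast h

/-- The price of giving up the indices in `W`: a correct output `i ∈ W` forces the input into `F i
×ˢ G i`. -/
theorem card_correctOutside_le_add (F : Z → Finset X) (G : Z → Finset Y) (g : X → Y → Z)
    (U W : Finset Z) (X₀ : Finset X) (Y₀ : Finset Y) {B : ℝ}
    (hB : ∀ i ∈ W, ((F i ∩ X₀).card : ℝ) * (G i ∩ Y₀).card ≤ B) :
    ((correctOutside F G g U (X₀ ×ˢ Y₀)).card : ℝ) ≤
      W.card * B + (correctOutside F G g (U ∪ W) (X₀ ×ˢ Y₀)).card := by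
  have hsub : correctOutside F G g U (X₀ ×ˢ Y₀) ⊆
      (W.biUnion fun i => (F i ∩ X₀) ×ˢ (G i ∩ Y₀)) ∪
        correctOutside F G g (U ∪ W) (X₀ ×ˢ Y₀) := by
    intro w hw
    simp only [correctOutside, mem_filter, mem_product, mem_union, mem_biUnion, mem_inter] at hw ⊢
    by_cases h : g w.1 w.2 ∈ W
    · exact Or.inl ⟨_, h, ⟨hw.2.2.1, hw.1.1⟩, hw.2.2.2, hw.1.2⟩
    · exact Or.inr ⟨hw.1, by tauto, hw.2.2⟩
  have h1 := (card_le_card hsub).trans (card_union_le _ _)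
  have h2 : ((W.biUnion fun i => (F i ∩ X₀) ×ˢ (G i ∩ Y₀)).card : ℝ) ≤ W.card * B := by
    calc ((W.biUnion fun i => (F i ∩ X₀) ×ˢ (G i ∩ Y₀)).card : ℝ)
        ≤ ∑ i ∈ W, (((F i ∩ X₀) ×ˢ (G i ∩ Y₀)).card : ℝ) := by exact_mod_cast card_biUnion_le
      _ ≤ ∑ _i ∈ W, B := sum_le_sum fun i hi => by
          rw [card_product]; push_cast; exact hB i hi
      _ = W.card * B := by simp
  have h3 : ((correctOutside F G g U (X₀ ×ˢ Y₀)).card : ℝ) ≤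
      (W.biUnion fun i => (F i ∩ X₀) ×ˢ (G i ∩ Y₀)).card +
        (correctOutside F G g (U ∪ W) (X₀ ×ˢ Y₀)).card := by exact_mod_cast h1
  linarith

theorem card_correctOutside_split_left (F : Z → Finset X) (G : Z → Finset Y) (bit : X → Bool)
    (g₀ g₁ : X → Y → Z) (U : Finset Z) (X₀ : Finset X) (Y₀ : Finset Y) :
    ((correctOutside F G (fun x y => if bit x = true then g₁ x y else g₀ x y) U
        (X₀ ×ˢ Y₀)).card : ℝ) ≤
      (correctOutside F G g₁ U ((X₀.filter fun x => bit x = true) ×ˢ Y₀)).card +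
      (correctOutside F G g₀ U ((X₀.filter fun x => ¬ bit x = true) ×ˢ Y₀)).card := by
  have : correctOutside F G (fun x y => if bit x = true then g₁ x y else g₀ x y) U (X₀ ×ˢ Y₀) ⊆
      correctOutside F G g₁ U ((X₀.filter fun x => bit x = true) ×ˢ Y₀) ∪
      correctOutside F G g₀ U ((X₀.filter fun x => ¬ bit x = true) ×ˢ Y₀) := by
    intro w hw
    simp only [correctOutside, mem_filter, mem_product, mem_union] at hw ⊢
    by_cases h : bit w.1 = true
    · simp only [h, if_true] at hw; left; tauto
    · simp only [h] at hw; right; simp_all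
  exact_mod_cast (card_le_card this).trans (card_union_le _ _)

theorem card_correctOutside_split_right (F : Z → Finset X) (G : Z → Finset Y) (bit : Y → Bool)
    (g₀ g₁ : X → Y → Z) (U : Finset Z) (X₀ : Finset X) (Y₀ : Finset Y) :
    ((correctOutside F G (fun x y => if bit y = true then g₁ x y else g₀ x y) U
        (X₀ ×ˢ Y₀)).card : ℝ) ≤
      (correctOutside F G g₁ U (X₀ ×ˢ (Y₀.filter fun y => bit y = true))).card +
      (correctOutside F G g₀ U (X₀ ×ˢ (Y₀.filter fun y => ¬ bit y = true))).card := by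
  have : correctOutside F G (fun x y => if bit y = true then g₁ x y else g₀ x y) U (X₀ ×ˢ Y₀) ⊆
      correctOutside F G g₁ U (X₀ ×ˢ (Y₀.filter fun y => bit y = true)) ∪
      correctOutside F G g₀ U (X₀ ×ˢ (Y₀.filter fun y => ¬ bit y = true)) := by
    intro w hw
    simp only [correctOutside, mem_filter, mem_product, mem_union] at hw ⊢
    by_cases h : bit w.2 = true
    · simp only [h, if_true] at hw; left; tauto
    · simp only [h] at hw; right; simp_all
  exact_mod_cast (card_le_card this).trans (card_union_le _ _)

/-- The `z` outside `U` such that `F z` has density more than `τ` in `X'`. -/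
noncomputable def denseIndices [Fintype Z] (F : Z → Finset X) (U : Finset Z) (τ : ℝ)
    (X' : Finset X) : Finset Z :=
  univ.filter fun i => i ∉ U ∧ τ * X'.card < (F i ∩ X').card

theorem denseIndices_anti [Fintype Z] (F : Z → Finset X) {U U' : Finset Z} (h : U ⊆ U') (τ : ℝ)
    (X' : Finset X) : denseIndices F U' τ X' ⊆ denseIndices F U τ X' := by
  intro i hi
  simp only [denseIndices, mem_filter, mem_univ, true_and] at hi ⊢
  exact ⟨fun hU => hi.1 (h hU), hi.2⟩

/-- If in every large set of inputs of either player only few indices are dense, a protocol of small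
depth rarely outputs an index that was not dense at the start and is correct. -/
theorem Protocol.card_correctOutside_le [Fintype X] [Fintype Y] [Fintype Z]
    (F : Z → Finset X) (G : Z → Finset Y) {τ σ M : ℝ} (hτ : 0 ≤ τ) (hσ : 0 ≤ σ) (hM : 0 ≤ M)
    (U₀ : Finset Z)
    (hX : ∀ X' : Finset X, σ * Fintype.card X ≤ X'.card → ((denseIndices F U₀ τ X').card : ℝ) ≤ M)
    (hY : ∀ Y' : Finset Y, σ * Fintype.card Y ≤ Y'.card → ((denseIndices G U₀ τ Y').card : ℝ) ≤ M)
    (T : Protocol X Y Z) :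
    ∀ (d : ℕ), T.depth ≤ d → ∀ (X₀ : Finset X) (Y₀ : Finset Y) (U : Finset Z), U₀ ⊆ U →
      (∀ i ∉ U, ((F i ∩ X₀).card : ℝ) ≤ τ * X₀.card ∧ ((G i ∩ Y₀).card : ℝ) ≤ τ * Y₀.card) →
      ((correctOutside F G T.eval U (X₀ ×ˢ Y₀)).card : ℝ) ≤
        X₀.card * Y₀.card * (τ ^ 2 * (2 * M * d + 1)) +
          2 ^ d * (σ * (Fintype.card X * Fintype.card Y)) := by
  have hN : 0 ≤ σ * ((Fintype.card X : ℝ) * Fintype.card Y) := by positivity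
  have hpow (d : ℕ) : σ * ((Fintype.card X : ℝ) * Fintype.card Y) ≤
      2 ^ d * (σ * (Fintype.card X * Fintype.card Y)) :=
    le_mul_of_one_le_left hN (one_le_pow₀ (by norm_num))
  induction T with
  | leaf out =>
    intro d _ X₀ Y₀ U _ hinv
    have h0 : 0 ≤ 2 ^ d * (σ * ((Fintype.card X : ℝ) * Fintype.card Y)) := by positivity
    have h2 : (X₀.card : ℝ) * Y₀.card * τ ^ 2 ≤
        X₀.card * Y₀.card * (τ ^ 2 * (2 * M * d + 1)) := by
      refine mul_le_mul_of_nonneg_left ?_ (by positivity)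
      refine le_mul_of_one_le_right (by positivity) ?_
      have : 0 ≤ 2 * M * d := by positivity
      linarith
    by_cases hU : out ∈ U
    · have : correctOutside F G (Protocol.leaf out : Protocol X Y Z).eval U (X₀ ×ˢ Y₀) = ∅ := by
        ext w; simp [correctOutside, Protocol.eval, hU]
      rw [this]; simp only [card_empty, Nat.cast_zero]; positivity
    · have hsub : correctOutside F G (Protocol.leaf out : Protocol X Y Z).eval U (X₀ ×ˢ Y₀) ⊆
          (F out ∩ X₀) ×ˢ (G out ∩ Y₀) := by
        intro w hw
        obtain ⟨h1, -, h2, h3⟩ := mem_filter.1 hw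
        rw [mem_product] at h1
        exact mem_product.2 ⟨mem_inter.2 ⟨h2, h1.1⟩, mem_inter.2 ⟨h3, h1.2⟩⟩
      have h1 := card_le_card hsub
      rw [card_product] at h1
      have h1' : ((correctOutside F G (Protocol.leaf out : Protocol X Y Z).eval U
          (X₀ ×ˢ Y₀)).card : ℝ) ≤ (F out ∩ X₀).card * (G out ∩ Y₀).card := by exact_mod_cast h1
      have h3 := mul_le_mul (hinv out hU).1 (hinv out hU).2 (by positivity) (by positivity)
      nlinarith
  | alice bit p₀ p₁ ih₀ ih₁ =>
    intro d hd X₀ Y₀ U hU hinv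
    obtain ⟨d, rfl⟩ : ∃ e, d = e + 1 := ⟨d - 1, by simp only [Protocol.depth] at hd; omega⟩
    have hd₀ : p₀.depth ≤ d := by simp only [Protocol.depth] at hd; omega
    have hd₁ : p₁.depth ≤ d := by simp only [Protocol.depth] at hd; omega
    have child (q : Protocol X Y Z) (hq : ∀ (X₀ : Finset X) (Y₀ : Finset Y) (U : Finset Z),
        U₀ ⊆ U → (∀ i ∉ U, ((F i ∩ X₀).card : ℝ) ≤ τ * X₀.card ∧
          ((G i ∩ Y₀).card : ℝ) ≤ τ * Y₀.card) →
        ((correctOutside F G q.eval U (X₀ ×ˢ Y₀)).card : ℝ) ≤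
          X₀.card * Y₀.card * (τ ^ 2 * (2 * M * d + 1)) +
            2 ^ d * (σ * (Fintype.card X * Fintype.card Y)))
        (X₁ : Finset X) (hX₁ : X₁ ⊆ X₀) :
        ((correctOutside F G q.eval U (X₁ ×ˢ Y₀)).card : ℝ) ≤
          M * ((τ * X₀.card) * (τ * Y₀.card)) +
          (X₁.card * Y₀.card * (τ ^ 2 * (2 * M * d + 1)) +
            2 ^ d * (σ * (Fintype.card X * Fintype.card Y))) := by
      have hMB : 0 ≤ M * ((τ * X₀.card) * (τ * Y₀.card)) := by positivity
      -- The density hypothesis says nothing about a part of density below `σ`; such a part is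
      -- written off whole, at cost at most `σ` times the number of all inputs.
      by_cases hs : σ * Fintype.card X ≤ X₁.card
      · refine (card_correctOutside_le_add F G q.eval U (denseIndices F U τ X₁) X₁ Y₀
          (B := (τ * X₀.card) * (τ * Y₀.card)) ?_).trans (add_le_add ?_ (hq _ _ _ ?_ ?_))
        · intro i hi
          simp only [denseIndices, mem_filter, mem_univ, true_and] at hi
          -- The index may be dense in `X₁`, but its cost is bounded by its density in the parent
          -- side `X₀`, where the invariant still holds.
          refine mul_le_mul ?_ (hinv i hi.1).2 (by positivity) (by positivity)
          refine le_trans ?_ (hinv i hi.1).1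
          exact_mod_cast card_le_card (inter_subset_inter_left hX₁)
        · refine mul_le_mul_of_nonneg_right ?_ (by positivity)
          refine le_trans ?_ (hX X₁ hs)
          exact_mod_cast card_le_card (denseIndices_anti F hU τ X₁)
        · exact hU.trans subset_union_left
        · intro i hi
          simp only [mem_union, not_or, denseIndices, mem_filter, mem_univ, true_and, not_and,
            not_lt] at hi
          exact ⟨hi.2 hi.1, (hinv i hi.1).2⟩
      · have h1 := card_correctOutside_le_card F G q.eval U X₁ Y₀
        have h2 : (X₁.card : ℝ) * Y₀.card ≤ (σ * Fintype.card X) * Fintype.card Y := by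
          refine mul_le_mul (not_le.mp hs).le ?_ (by positivity) (by positivity)
          exact_mod_cast card_le_univ Y₀
        have h3 : 0 ≤ X₁.card * Y₀.card * (τ ^ 2 * (2 * M * d + 1)) := by positivity
        have h4 := hpow d
        linarith
    have hsplit := card_correctOutside_split_left F G bit p₀.eval p₁.eval U X₀ Y₀
    have e₁ := child p₁ (ih₁ d hd₁) (X₀.filter fun x => bit x = true) (filter_subset _ _)
    have e₀ := child p₀ (ih₀ d hd₀) (X₀.filter fun x => ¬ bit x = true) (filter_subset _ _)
    have hcard : ((X₀.filter fun x => bit x = true).card : ℝ) +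
        (X₀.filter fun x => ¬ bit x = true).card = X₀.card := by
      exact_mod_cast card_filter_add_card_filter_not (s := X₀) (fun x => bit x = true)
    change ((correctOutside F G (fun x y => if bit x = true then p₁.eval x y else p₀.eval x y) U
      (X₀ ×ˢ Y₀)).card : ℝ) ≤ _
    -- The main terms of the two children add up to that of the parent; the two costs of new dense
    -- indices turn `2 * M * d` into `2 * M * (d + 1)`.
    refine hsplit.trans ((add_le_add e₁ e₀).trans (le_of_eq ?_))
    rw [← hcard]; push_cast; ring
  | bob bit p₀ p₁ ih₀ ih₁ =>
    intro d hd X₀ Y₀ U hU hinv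
    obtain ⟨d, rfl⟩ : ∃ e, d = e + 1 := ⟨d - 1, by simp only [Protocol.depth] at hd; omega⟩
    have hd₀ : p₀.depth ≤ d := by simp only [Protocol.depth] at hd; omega
    have hd₁ : p₁.depth ≤ d := by simp only [Protocol.depth] at hd; omega
    have child (q : Protocol X Y Z) (hq : ∀ (X₀ : Finset X) (Y₀ : Finset Y) (U : Finset Z),
        U₀ ⊆ U → (∀ i ∉ U, ((F i ∩ X₀).card : ℝ) ≤ τ * X₀.card ∧
          ((G i ∩ Y₀).card : ℝ) ≤ τ * Y₀.card) →
        ((correctOutside F G q.eval U (X₀ ×ˢ Y₀)).card : ℝ) ≤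
          X₀.card * Y₀.card * (τ ^ 2 * (2 * M * d + 1)) +
            2 ^ d * (σ * (Fintype.card X * Fintype.card Y)))
        (Y₁ : Finset Y) (hY₁ : Y₁ ⊆ Y₀) :
        ((correctOutside F G q.eval U (X₀ ×ˢ Y₁)).card : ℝ) ≤
          M * ((τ * X₀.card) * (τ * Y₀.card)) +
          (X₀.card * Y₁.card * (τ ^ 2 * (2 * M * d + 1)) +
            2 ^ d * (σ * (Fintype.card X * Fintype.card Y))) := by
      have hMB : 0 ≤ M * ((τ * X₀.card) * (τ * Y₀.card)) := by positivity
      by_cases hs : σ * Fintype.card Y ≤ Y₁.card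
      · refine (card_correctOutside_le_add F G q.eval U (denseIndices G U τ Y₁) X₀ Y₁
          (B := (τ * X₀.card) * (τ * Y₀.card)) ?_).trans (add_le_add ?_ (hq _ _ _ ?_ ?_))
        · intro i hi
          simp only [denseIndices, mem_filter, mem_univ, true_and] at hi
          refine mul_le_mul (hinv i hi.1).1 ?_ (by positivity) (by positivity)
          refine le_trans ?_ (hinv i hi.1).2
          exact_mod_cast card_le_card (inter_subset_inter_left hY₁)
        · refine mul_le_mul_of_nonneg_right ?_ (by positivity)
          refine le_trans ?_ (hY Y₁ hs)
          exact_mod_cast card_le_card (denseIndices_anti G hU τ Y₁)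
        · exact hU.trans subset_union_left
        · intro i hi
          simp only [mem_union, not_or, denseIndices, mem_filter, mem_univ, true_and, not_and,
            not_lt] at hi
          exact ⟨(hinv i hi.1).1, hi.2 hi.1⟩
      · have h1 := card_correctOutside_le_card F G q.eval U X₀ Y₁
        have h2 : (X₀.card : ℝ) * Y₁.card ≤ Fintype.card X * (σ * Fintype.card Y) := by
          refine mul_le_mul ?_ (not_le.mp hs).le (by positivity) (by positivity)
          exact_mod_cast card_le_univ X₀
        have h3 : 0 ≤ X₀.card * Y₁.card * (τ ^ 2 * (2 * M * d + 1)) := by positivity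
        have h4 := hpow d
        linarith
    have hsplit := card_correctOutside_split_right F G bit p₀.eval p₁.eval U X₀ Y₀
    have e₁ := child p₁ (ih₁ d hd₁) (Y₀.filter fun y => bit y = true) (filter_subset _ _)
    have e₀ := child p₀ (ih₀ d hd₀) (Y₀.filter fun y => ¬ bit y = true) (filter_subset _ _)
    have hcard : ((Y₀.filter fun y => bit y = true).card : ℝ) +
        (Y₀.filter fun y => ¬ bit y = true).card = Y₀.card := by
      exact_mod_cast card_filter_add_card_filter_not (s := Y₀) (fun y => bit y = true)
    change ((correctOutside F G (fun x y => if bit y = true then p₁.eval x y else p₀.eval x y) U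
      (X₀ ×ˢ Y₀)).card : ℝ) ≤ _
    refine hsplit.trans ((add_le_add e₁ e₀).trans (le_of_eq ?_))
    rw [← hcard]; push_cast; ring

end Protocols

/-! ### From deterministic to randomized protocols -/

section Averaging

variable {X Y Z : Type}

open Classical in
/-- If every deterministic protocol in the support succeeds on at most `B` inputs, a randomized
protocol that succeeds with probability `p` on each of the inputs in `D` has `p * |D| ≤ B`. -/
theorem RandProtocol.mul_card_le [Fintype X] [Fintype Y] (P : RandProtocol X Y Z)
    (good : X → Y → Set Z) (D : Finset (X × Y)) {p B : ℝ} (hB : 0 ≤ B)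
    (hD : ∀ w ∈ D, ENNReal.ofReal p ≤
      P.toOuterMeasure {T | T.eval w.1 w.2 ∈ good w.1 w.2})
    (hP : ∀ T ∈ P.support,
      ((D.filter fun w => T.eval w.1 w.2 ∈ good w.1 w.2).card : ℝ) ≤ B) :
    p * D.card ≤ B := by
  have h1 : (D.card : ENNReal) * ENNReal.ofReal p ≤ ENNReal.ofReal B := by
    calc (D.card : ENNReal) * ENNReal.ofReal p = ∑ _w ∈ D, ENNReal.ofReal p := by simp
      _ ≤ ∑ w ∈ D, ∑' T, Set.indicator {T | T.eval w.1 w.2 ∈ good w.1 w.2} P T :=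
          sum_le_sum fun w hw => by
            have := hD w hw; rwa [PMF.toOuterMeasure_apply] at this
      _ = ∑' T, ∑ w ∈ D, Set.indicator {T | T.eval w.1 w.2 ∈ good w.1 w.2} P T := by
          rw [Summable.tsum_finsetSum]; intro i _; exact ENNReal.summable
      _ ≤ ∑' T, P T * ENNReal.ofReal B := ENNReal.tsum_le_tsum fun T => by
          have : ∑ w ∈ D, Set.indicator {T : Protocol X Y Z | T.eval w.1 w.2 ∈ good w.1 w.2} P T =
              P T * ((D.filter fun w => T.eval w.1 w.2 ∈ good w.1 w.2).card : ENNReal) := by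
            simp only [Set.indicator_apply, Set.mem_ofPred_eq]
            rw [← sum_filter, sum_const, nsmul_eq_mul, mul_comm]
          rw [this]
          by_cases hT : T ∈ P.support
          · refine mul_le_mul_right ?_ _
            rw [← ENNReal.ofReal_natCast]
            exact ENNReal.ofReal_le_ofReal (hP T hT)
          · rw [PMF.mem_support_iff, not_not] at hT; simp [hT]
      _ = ENNReal.ofReal B := by rw [ENNReal.tsum_mul_right, P.tsum_coe, one_mul]
  rw [← ENNReal.ofReal_natCast, ← ENNReal.ofReal_mul (by positivity),
    ENNReal.ofReal_le_ofReal_iff hB] at h1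
  linarith

end Averaging

/-! ### Factorial moments of families of subcubes -/

section Moments

variable {J ι : Type} [Fintype J]

theorem card_mul_two_pow_le_of_agree [DecidableEq J] (V : Finset J) (H : Finset (J → Bool))
    (hH : ∀ x ∈ H, ∀ x' ∈ H, ∀ j ∈ V, x j = x' j) :
    H.card * 2 ^ V.card ≤ 2 ^ Fintype.card J := by
  have h1 : H.card ≤ (univ : Finset ({j // j ∉ V} → Bool)).card := by
    refine card_le_card_of_injOn (fun x j => x j.1) (fun _ _ => mem_coe.2 (mem_univ _)) ?_
    intro x hx x' hx' hxx
    funext j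
    by_cases hj : j ∈ V
    · exact hH x hx x' hx' j hj
    · exact congrFun hxx ⟨j, hj⟩
  have h2 : (univ : Finset ({j // j ∉ V} → Bool)).card = 2 ^ (Fintype.card J - V.card) := by
    rw [card_univ, Fintype.card_fun, Fintype.card_bool, Fintype.card_subtype_compl]
    simp
  rw [h2] at h1
  calc H.card * 2 ^ V.card ≤ 2 ^ (Fintype.card J - V.card) * 2 ^ V.card :=
        Nat.mul_le_mul_right _ h1
    _ = 2 ^ Fintype.card J := by
        rw [← pow_add, Nat.sub_add_cancel (card_le_univ V)]

/-- The factorial moment estimate: a family of cubes whose `r`-fold intersections have codimension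
at least `e` cannot have density at least `τ` in a large set. -/
theorem factorial_moment_bound [DecidableEq J] [DecidableEq (J → Bool)] [DecidableEq ι]
    (V : ι → Finset J) (F : ι → Finset (J → Bool))
    (hF : ∀ i, ∀ x ∈ F i, ∀ x' ∈ F i, ∀ j ∈ V i, x j = x' j) (S : Finset ι) (r e : ℕ)
    (hS : ∀ T ⊆ S, T.card = r → e ≤ (T.biUnion V).card) (X' : Finset (J → Bool)) {τ : ℝ}
    (hτ : 0 < τ) (hdense : ∀ i ∈ S, τ * X'.card ≤ (F i ∩ X').card)
    (hcard : 4 * (r : ℝ) ≤ S.card * τ) (hS0 : 0 < S.card) :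
    τ / 2 * X'.card * (τ / 4) ^ r * 2 ^ e ≤ 2 ^ Fintype.card J := by
  set N : ℝ := (S.card : ℝ) with hN
  have hN0 : 0 < N := by rw [hN]; exact_mod_cast hS0
  let Z : (J → Bool) → Finset ι := fun x => S.filter fun i => x ∈ F i
  let H : Finset (J → Bool) := X'.filter fun x => N * τ / 2 ≤ (Z x).card
  have hsum : ∑ x ∈ X', ((Z x).card : ℝ) = ∑ i ∈ S, ((F i ∩ X').card : ℝ) := by
    have := sum_card_bipartiteAbove_eq_sum_card_bipartiteBelow (s := X') (t := S)
      (fun x i => x ∈ F i)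
    have h2 (i : ι) : (X'.filter fun x => x ∈ F i) = F i ∩ X' := by
      ext x; simp [and_comm]
    simp only [bipartiteAbove, bipartiteBelow, h2] at this
    exact_mod_cast this
  have hlow : N * (τ * X'.card) ≤ ∑ x ∈ X', ((Z x).card : ℝ) := by
    rw [hsum]
    calc N * (τ * X'.card) = ∑ _i ∈ S, τ * X'.card := by simp [hN]
      _ ≤ _ := sum_le_sum hdense
  -- Reverse Markov: the mean of `(Z x).card` over `X'` is at least `N * τ` and its maximum at most
  -- `N`, so at least a `τ / 2` fraction of `X'` reaches half of `N * τ`.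
  have hup : ∑ x ∈ X', ((Z x).card : ℝ) ≤ H.card * N + X'.card * (N * τ / 2) := by
    calc ∑ x ∈ X', ((Z x).card : ℝ)
        ≤ ∑ x ∈ X', ((if N * τ / 2 ≤ (Z x).card then N else 0) + N * τ / 2) := by
          refine sum_le_sum fun x _ => ?_
          split_ifs with h
          · have : ((Z x).card : ℝ) ≤ N := by
              rw [hN]; exact_mod_cast card_le_card (filter_subset _ _)
            have : 0 ≤ N * τ / 2 := by positivity
            linarith
          · linarith
      _ = H.card * N + X'.card * (N * τ / 2) := by
          rw [sum_add_distrib, ← sum_filter]; simp [H]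
  have hH : τ / 2 * X'.card ≤ H.card := by
    have : N * (τ / 2 * X'.card) ≤ N * H.card := by nlinarith
    exact le_of_mul_le_mul_left this hN0
  -- Double counting of pairs of a point `x ∈ H` and an `r`-set of cubes that all contain `x`.
  have hmom : ∑ x ∈ H, ((Z x).card.choose r) * 2 ^ e ≤ S.card.choose r * 2 ^ Fintype.card J := by
    calc ∑ x ∈ H, ((Z x).card.choose r) * 2 ^ e
        = ∑ x ∈ H, ((powersetCard r S).filter fun T => ∀ i ∈ T, x ∈ F i).card * 2 ^ e := by
          refine sum_congr rfl fun x _ => ?_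
          rw [← card_powersetCard]
          congr 2
          ext T
          simp only [mem_powersetCard, mem_filter, Z, subset_iff]
          constructor
          · rintro ⟨h1, h2⟩; exact ⟨⟨fun i hi => (h1 hi).1, h2⟩, fun i hi => (h1 hi).2⟩
          · rintro ⟨⟨h1, h2⟩, h3⟩; exact ⟨fun i hi => ⟨h1 hi, h3 i hi⟩, h2⟩
      _ = ∑ T ∈ powersetCard r S, (H.filter fun x => ∀ i ∈ T, x ∈ F i).card * 2 ^ e := by
          rw [← sum_mul, ← sum_mul]
          congr 1
          exact sum_card_bipartiteAbove_eq_sum_card_bipartiteBelow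
            (fun x (T : Finset ι) => ∀ i ∈ T, x ∈ F i)
      _ ≤ ∑ T ∈ powersetCard r S, 2 ^ Fintype.card J := by
          refine sum_le_sum fun T hT => ?_
          rw [mem_powersetCard] at hT
          refine le_trans (Nat.mul_le_mul_left _ (Nat.pow_le_pow_right (by norm_num)
            (hS T hT.1 hT.2))) (card_mul_two_pow_le_of_agree (T.biUnion V) _ ?_)
          intro x hx x' hx' j hj
          rw [mem_biUnion] at hj
          obtain ⟨i, hi, hj⟩ := hj
          exact hF i x ((mem_filter.1 hx).2 i hi) x' ((mem_filter.1 hx').2 i hi) j hj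
      _ = _ := by simp
  -- `hcard` gives `r ≤ N * τ / 4`, so each of the `r` factors of the falling factorial is at least
  -- `N * τ / 2 - r ≥ N * τ / 4`.
  have hchoose : ∀ x ∈ H, (N * τ / 4) ^ r / r.factorial ≤ ((Z x).card.choose r : ℝ) := by
    intro x hx
    have hz := (mem_filter.1 hx).2
    have h1 := Nat.pow_le_choose (α := ℝ) r (Z x).card
    refine le_trans ?_ h1
    have hr : (r : ℝ) ≤ (Z x).card := by linarith [Nat.cast_nonneg (α := ℝ) r]
    have hr' : r ≤ (Z x).card + 1 := by
      have : r ≤ (Z x).card := by exact_mod_cast hr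
      omega
    gcongr
    rw [Nat.cast_sub hr']
    push_cast
    linarith
  have hmom' : (H.card : ℝ) * ((N * τ / 4) ^ r / r.factorial) * 2 ^ e ≤
      N ^ r / r.factorial * 2 ^ Fintype.card J := by
    calc (H.card : ℝ) * ((N * τ / 4) ^ r / r.factorial) * 2 ^ e
        = ∑ _x ∈ H, ((N * τ / 4) ^ r / r.factorial) * 2 ^ e := by simp [mul_assoc]
      _ ≤ ∑ x ∈ H, ((Z x).card.choose r : ℝ) * 2 ^ e :=
          sum_le_sum fun x hx => mul_le_mul_of_nonneg_right (hchoose x hx) (by positivity)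
      _ ≤ (S.card.choose r : ℝ) * 2 ^ Fintype.card J := by exact_mod_cast hmom
      _ ≤ _ := mul_le_mul_of_nonneg_right (Nat.choose_le_pow_div r S.card) (by positivity)
  have hf : (0 : ℝ) < r.factorial := by exact_mod_cast r.factorial_pos
  have hkey : N ^ r / r.factorial * (H.card * (τ / 4) ^ r * 2 ^ e) ≤
      N ^ r / r.factorial * 2 ^ Fintype.card J := by
    refine le_trans (le_of_eq ?_) hmom'
    rw [mul_div_assoc, mul_pow]; ring
  have := le_of_mul_le_mul_left hkey (by positivity)
  refine le_trans ?_ this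
  gcongr

end Moments

/-! ### Expanding formulas and the communication trade-off -/

section Formulas

variable {m n Δ : ℕ}

/-- The set of variables of a clause. -/
def Clause.vars (C : Clause n Δ) : Finset (Fin n) := C.1.1

theorem Clause.card_vars (C : Clause n Δ) : C.vars.card = Δ := C.1.2

/-- The variables of a clause satisfying `P`. -/
def Clause.sideVars (P : Fin n → Prop) [Fintype {j // P j}] (C : Clause n Δ) :
    Finset {j // P j} :=
  univ.filter fun j => j.1 ∈ C.vars

/-- The assignments to the variables satisfying `P` which falsify all literals of the clause over
these variables. -/
def Clause.sideFalsifying (P : Fin n → Prop) [Fintype {j // P j}] (C : Clause n Δ) :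
    Finset ({j // P j} → Bool) :=
  univ.filter fun x => ∀ (j : {j // P j}) (h : j.1 ∈ C.1.1), x j ≠ C.2 ⟨j.1, h⟩

theorem Clause.eq_of_mem_sideFalsifying {P : Fin n → Prop} [Fintype {j // P j}] (C : Clause n Δ)
    {x x' : {j // P j} → Bool} (hx : x ∈ C.sideFalsifying P) (hx' : x' ∈ C.sideFalsifying P)
    {j : {j // P j}} (hj : j ∈ C.sideVars P) : x j = x' j := by
  simp only [sideFalsifying, sideVars, mem_filter, mem_univ, true_and] at hx hx' hj
  have h1 := hx j hj
  have h2 := hx' j hj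
  revert h1 h2
  cases x j <;> cases x' j <;> cases C.2 ⟨j.1, hj⟩ <;> simp

theorem Clause.falsified_join_iff (C : Clause n Δ) (A : Finset (Fin n)) (x : AliceInput A)
    (y : BobInput A) : C.Falsified (join A x y) ↔
      x ∈ C.sideFalsifying (· ∈ A) ∧ y ∈ C.sideFalsifying (· ∉ A) := by
  simp only [sideFalsifying, mem_filter, mem_univ, true_and, Falsified]
  constructor
  · intro h
    refine ⟨fun j hj => ?_, fun j hj => ?_⟩
    · have := h ⟨j.1, hj⟩
      simpa [join, j.2] using this
    · have := h ⟨j.1, hj⟩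
      simpa [join, j.2] using this
  · rintro ⟨h1, h2⟩ ⟨j, hj⟩
    by_cases hA : j ∈ A
    · simpa [join, hA] using h1 ⟨j, hA⟩ hj
    · simpa [join, hA] using h2 ⟨j, hA⟩ hj

theorem card_biUnion_sideVars {ι : Type} (P : Fin n → Prop) [Fintype {j // P j}] [DecidablePred P]
    (φ : ι → Clause n Δ) (T : Finset ι) :
    (T.biUnion fun i => (φ i).sideVars P).card =
      ((T.biUnion fun i => (φ i).vars).filter P).card := by
  rw [← card_map (Function.Embedding.subtype P)]
  congr 1
  ext j
  simp only [Clause.sideVars, Finset.mem_map, mem_biUnion, mem_filter, mem_univ, true_and,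
    Function.Embedding.subtype_apply, Subtype.exists, exists_and_right, exists_eq_right]
  tauto

theorem Clause.card_sideVars (P : Fin n → Prop) [Fintype {j // P j}] [DecidablePred P]
    (C : Clause n Δ) :
    (C.sideVars P).card = (C.vars.filter P).card := by
  have := card_biUnion_sideVars P (fun _ : Unit => C) {()}
  simpa using this

theorem Clause.card_sideFalsifying_mul_le (P : Fin n → Prop) [Fintype {j // P j}] [DecidablePred P]
    (C : Clause n Δ) : (C.sideFalsifying P).card * 2 ^ (C.vars.filter P).card ≤
      2 ^ Fintype.card {j // P j} := by
  rw [← C.card_sideVars P]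
  exact card_mul_two_pow_le_of_agree _ _ fun x hx x' hx' j hj =>
    C.eq_of_mem_sideFalsifying hx hx' hj

/-- Any `r` clauses together contain at least `7/8` of the possible number of variables. -/
def Formula.Expands (φ : Formula m n Δ) (r : ℕ) : Prop :=
  ∀ T : Finset (Fin m), T.card = r → 7 * (r * Δ) ≤ 8 * (T.biUnion fun i => (φ i).vars).card

/-- Each clause has at most `3 / 4 * Δ` variables off the side, so of the `7 / 8 * r * Δ` variables
in the union at least `(7 / 8 - 3 / 4) * r * Δ` lie on it. -/
theorem Formula.Expands.card_side {φ : Formula m n Δ} {r : ℕ} (h : φ.Expands r)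
    (P : Fin n → Prop) [Fintype {j // P j}] [DecidablePred P] {T : Finset (Fin m)} (hT : T.card = r)
    (hP : ∀ i ∈ T, Δ ≤ 4 * ((φ i).vars.filter P).card) :
    r * Δ ≤ 8 * (T.biUnion fun i => (φ i).sideVars P).card := by
  have h1 := h T hT
  rw [card_biUnion_sideVars]
  set W := T.biUnion fun i => (φ i).vars
  have h2 : (W.filter P).card + (W.filter fun j => ¬ P j).card = W.card :=
    card_filter_add_card_filter_not _
  have h3 : 4 * (W.filter fun j => ¬ P j).card ≤ r * (3 * Δ) := by
    calc 4 * (W.filter fun j => ¬ P j).card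
        ≤ 4 * ∑ i ∈ T, ((φ i).vars.filter fun j => ¬ P j).card := by
          rw [show (W.filter fun j => ¬ P j) =
            T.biUnion fun i => (φ i).vars.filter fun j => ¬ P j from filter_biUnion _ _ _]
          exact Nat.mul_le_mul_left _ card_biUnion_le
      _ = ∑ i ∈ T, 4 * ((φ i).vars.filter fun j => ¬ P j).card := by rw [mul_sum]
      _ ≤ ∑ _i ∈ T, 3 * Δ := by
          refine sum_le_sum fun i hi => ?_
          have h4 : ((φ i).vars.filter P).card + ((φ i).vars.filter fun j => ¬ P j).card =
            (φ i).vars.card := card_filter_add_card_filter_not _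
          have h5 := hP i hi
          rw [(φ i).card_vars] at h4
          omega
      _ = r * (3 * Δ) := by rw [sum_const, hT, smul_eq_mul]
  nlinarith

/-- In a large set of one-sided inputs, few of the clauses with many variables on that side are
falsified with high density. -/
theorem Formula.Expands.card_denseIndices_le {φ : Formula m n Δ} {r : ℕ} (h : φ.Expands r)
    (P : Fin n → Prop) [Fintype {j // P j}] [DecidablePred P] {τ σ : ℝ} (hτ : 0 < τ) (hr : 0 < r)
    (hnum : ∀ e : ℕ, r * Δ ≤ 8 * e → 1 < τ / 2 * σ * (τ / 4) ^ r * 2 ^ e)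
    (U₀ : Finset (Fin m)) (hU₀ : ∀ i ∉ U₀, Δ ≤ 4 * ((φ i).vars.filter P).card)
    (X' : Finset ({j // P j} → Bool))
    (hX' : σ * Fintype.card ({j // P j} → Bool) ≤ X'.card) :
    ((denseIndices (fun i => (φ i).sideFalsifying P) U₀ τ X').card : ℝ) ≤ 4 * r / τ := by
  by_contra hlt
  rw [not_le, div_lt_iff₀ hτ] at hlt
  set S := denseIndices (fun i => (φ i).sideFalsifying P) U₀ τ X' with hS
  have hr' : (0 : ℝ) < r := by exact_mod_cast hr
  have hS0 : 0 < S.card := by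
    have : (0 : ℝ) < S.card * τ := by linarith
    exact_mod_cast pos_of_mul_pos_left this hτ.le
  have hmem : ∀ i ∈ S, i ∉ U₀ ∧ τ * X'.card < ((φ i).sideFalsifying P ∩ X').card := by
    intro i hi
    simpa only [hS, denseIndices, mem_filter, mem_univ, true_and] using hi
  -- The codimension `(r * Δ + 7) / 8` is `r * Δ / 8` rounded up.
  have hb := factorial_moment_bound (fun i => (φ i).sideVars P)
    (fun i => (φ i).sideFalsifying P)
    (fun i x hx x' hx' j hj => (φ i).eq_of_mem_sideFalsifying hx hx' hj) S r ((r * Δ + 7) / 8)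
    (fun T hT hTr => by
      have := h.card_side P hTr fun i hi => hU₀ i (hmem i (hT hi)).1
      have h2 : r * Δ ≤ 8 * (T.biUnion fun i => (φ i).sideVars P).card := by convert this
      convert (by omega : (r * Δ + 7) / 8 ≤ (T.biUnion fun i => (φ i).sideVars P).card))
    X' hτ (fun i hi => by convert (hmem i hi).2.le) hlt.le hS0
  have hn := hnum ((r * Δ + 7) / 8) (by omega)
  rw [Fintype.card_fun, Fintype.card_bool] at hX'
  push_cast at hX'
  have h2 : (0 : ℝ) < 2 ^ Fintype.card {j // P j} := by positivity
  have h3 : τ / 2 * (σ * 2 ^ Fintype.card {j // P j}) * (τ / 4) ^ r * 2 ^ ((r * Δ + 7) / 8) ≤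
      2 ^ Fintype.card {j // P j} := by
    refine le_trans ?_ hb
    gcongr
  nlinarith

/-- The clauses with fewer than a quarter of their variables on one of the two sides. -/
def Formula.unbalanced (φ : Formula m n Δ) (A : Finset (Fin n)) : Finset (Fin m) :=
  univ.filter fun i => 4 * ((φ i).vars.filter (· ∈ A)).card < Δ ∨
    4 * ((φ i).vars.filter (· ∉ A)).card < Δ

theorem join_injective (A : Finset (Fin n)) :
    Function.Injective fun w : AliceInput A × BobInput A => join A w.1 w.2 := by
  rintro ⟨x, y⟩ ⟨x', y'⟩ h
  refine Prod.ext (funext fun j => ?_) (funext fun j => ?_)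
  · have := congrFun h j.1
    simpa [join, j.2] using this
  · have := congrFun h j.1
    simpa [join, j.2] using this

theorem card_side_add (A : Finset (Fin n)) :
    Fintype.card {j // j ∈ A} + Fintype.card {j // j ∉ A} = n := by
  rw [Fintype.card_subtype_compl]
  have := Fintype.card_subtype_le (fun j => j ∈ A)
  simp only [Fintype.card_fin, Fintype.card_coe] at this ⊢
  omega

theorem card_inputs_mul (A : Finset (Fin n)) :
    (Fintype.card (AliceInput A) : ℝ) * Fintype.card (BobInput A) = 2 ^ n := by
  rw [Fintype.card_fun, Fintype.card_fun, Fintype.card_bool]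
  push_cast
  rw [← pow_add, card_side_add]

theorem Clause.density_sideFalsifying_le (P : Fin n → Prop) [Fintype {j // P j}] [DecidablePred P]
    (C : Clause n Δ) {τ : ℝ} (hinit : ∀ w : ℕ, Δ ≤ 4 * w → 1 ≤ τ * 2 ^ w)
    (hw : Δ ≤ 4 * (C.vars.filter P).card) :
    ((C.sideFalsifying P).card : ℝ) ≤ τ * Fintype.card ({j // P j} → Bool) := by
  have h1 : ((C.sideFalsifying P).card : ℝ) * 2 ^ (C.vars.filter P).card ≤
      2 ^ Fintype.card {j // P j} := by exact_mod_cast C.card_sideFalsifying_mul_le P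
  have h2 := hinit _ hw
  rw [Fintype.card_fun, Fintype.card_bool]
  push_cast
  have h3 : (0 : ℝ) < 2 ^ (C.vars.filter P).card := by positivity
  have hτ : 0 ≤ τ := by
    by_contra hτ
    nlinarith
  calc ((C.sideFalsifying P).card : ℝ)
      ≤ (C.sideFalsifying P).card * (τ * 2 ^ (C.vars.filter P).card) :=
        le_mul_of_one_le_right (by positivity) h2
    _ = τ * ((C.sideFalsifying P).card * 2 ^ (C.vars.filter P).card) := by ring
    _ ≤ _ := mul_le_mul_of_nonneg_left h1 hτ

/-- The codimensions of the two subcubes add up to `Δ`, however unevenly the clause is split. -/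
theorem Clause.card_sideFalsifying_mul_card_le (C : Clause n Δ) (A : Finset (Fin n)) :
    ((C.sideFalsifying (· ∈ A)).card : ℝ) * (C.sideFalsifying (· ∉ A)).card ≤ 2 ^ n / 2 ^ Δ := by
  rw [le_div_iff₀ (by positivity)]
  have h := Nat.mul_le_mul (C.card_sideFalsifying_mul_le (· ∈ A))
    (C.card_sideFalsifying_mul_le (· ∉ A))
  have h2 : (C.vars.filter (· ∈ A)).card + (C.vars.filter (· ∉ A)).card = Δ := by
    exact (card_filter_add_card_filter_not _).trans C.card_vars
  rw [← pow_add, card_side_add, mul_mul_mul_comm, ← pow_add] at h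
  have h3 : (C.sideFalsifying (· ∈ A)).card * (C.sideFalsifying (· ∉ A)).card * 2 ^ Δ ≤ 2 ^ n := by
    refine le_trans (le_of_eq ?_) h
    congr 2
    exact h2.symm
  exact_mod_cast h3

open Classical in
/-- The number of satisfying assignments. -/
noncomputable def Formula.numSat (φ : Formula m n Δ) : ℕ :=
  (univ.filter fun z : Fin n → Bool => ∀ i, ¬ (φ i).Falsified z).card

open Classical in
/-- The trade-off between communication and success probability for an expanding formula. -/
theorem Formula.Expands.success_le {φ : Formula m n Δ} {r : ℕ} (h : φ.Expands r)
    (A : Finset (Fin n)) {τ σ p : ℝ} (hτ : 0 < τ) (hσ : 0 ≤ σ) (hp : 0 ≤ p) (hr : 0 < r)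
    (hnum : ∀ e : ℕ, r * Δ ≤ 8 * e → 1 < τ / 2 * σ * (τ / 4) ^ r * 2 ^ e)
    (hinit : ∀ w : ℕ, Δ ≤ 4 * w → 1 ≤ τ * 2 ^ w)
    (hsat : 2 * (φ.numSat : ℝ) ≤ 2 ^ n)
    (P : RandProtocol (AliceInput A) (BobInput A) (Fin m)) {d : ℕ} (hd : P.CommAtMost d)
    (hP : SolvesSearch φ A P p) :
    p / 2 ≤ (φ.unbalanced A).card / 2 ^ Δ + τ ^ 2 * (2 * (4 * r / τ) * d + 1) + 2 ^ d * σ := by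
  let F : Fin m → Finset (AliceInput A) := fun i => (φ i).sideFalsifying (· ∈ A)
  let G : Fin m → Finset (BobInput A) := fun i => (φ i).sideFalsifying (· ∉ A)
  let U := φ.unbalanced A
  have hU : ∀ i ∉ U, Δ ≤ 4 * ((φ i).vars.filter (· ∈ A)).card ∧
      Δ ≤ 4 * ((φ i).vars.filter (· ∉ A)).card := by
    intro i hi
    simpa only [U, unbalanced, mem_filter, mem_univ, true_and, not_or, not_lt] using hi
  let D : Finset (AliceInput A × BobInput A) :=
    univ.filter fun w => ∃ i, (φ i).Falsified (join A w.1 w.2)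
  have hcards := card_inputs_mul A
  have h2n : (0 : ℝ) < 2 ^ n := by positivity
  have hDcard : (2 : ℝ) ^ n ≤ 2 * D.card := by
    have h1 : (univ.filter fun w : AliceInput A × BobInput A =>
        ¬ ∃ i, (φ i).Falsified (join A w.1 w.2)).card ≤ φ.numSat := by
      refine card_le_card_of_injOn (fun w => join A w.1 w.2) ?_ (join_injective A).injOn
      intro w hw
      simpa using hw
    have h2 : D.card + (univ.filter fun w : AliceInput A × BobInput A =>
        ¬ ∃ i, (φ i).Falsified (join A w.1 w.2)).card =
        Fintype.card (AliceInput A) * Fintype.card (BobInput A) := by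
      rw [← Fintype.card_prod, ← card_univ]
      exact card_filter_add_card_filter_not _
    have h3 : (D.card : ℝ) + (univ.filter fun w : AliceInput A × BobInput A =>
        ¬ ∃ i, (φ i).Falsified (join A w.1 w.2)).card = 2 ^ n := by
      rw [← hcards]; exact_mod_cast h2
    have h4 : ((univ.filter fun w : AliceInput A × BobInput A =>
        ¬ ∃ i, (φ i).Falsified (join A w.1 w.2)).card : ℝ) ≤ φ.numSat := by exact_mod_cast h1
    linarith
  have hdet : ∀ T : Protocol (AliceInput A) (BobInput A) (Fin m), T.depth ≤ d →
      ((D.filter fun w => T.eval w.1 w.2 ∈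
        {i | (φ i).Falsified (join A w.1 w.2)}).card : ℝ) ≤
      2 ^ n * ((φ.unbalanced A).card / 2 ^ Δ + τ ^ 2 * (2 * (4 * r / τ) * d + 1) + 2 ^ d * σ) := by
    intro T hT
    have hsub : (D.filter fun w => T.eval w.1 w.2 ∈ {i | (φ i).Falsified (join A w.1 w.2)}) ⊆
        correctOutside F G T.eval ∅ (univ ×ˢ univ) := by
      intro w hw
      have hw2 := (mem_filter.1 hw).2
      rw [Set.mem_ofPred_eq, Clause.falsified_join_iff] at hw2
      exact mem_filter.2 ⟨by simp, by simp, hw2⟩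
    -- The unbalanced clauses are given up before the first bit, which makes all remaining indices
    -- sparse in the full input sets.
    have h1 := card_correctOutside_le_add F G T.eval ∅ U univ univ (B := 2 ^ n / 2 ^ Δ)
      (fun i _ => by
        rw [inter_univ, inter_univ]
        exact (φ i).card_sideFalsifying_mul_card_le A)
    have h2 := T.card_correctOutside_le F G hτ.le hσ (M := 4 * r / τ) (by positivity) U
      (fun X' hX' => h.card_denseIndices_le (· ∈ A) hτ hr hnum U (fun i hi => (hU i hi).1) X' hX')
      (fun Y' hY' => h.card_denseIndices_le (· ∉ A) hτ hr hnum U (fun i hi => (hU i hi).2) Y' hY')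
      d hT univ univ U subset_rfl (fun i hi => by
        rw [inter_univ, inter_univ, card_univ, card_univ]
        exact ⟨(φ i).density_sideFalsifying_le _ hinit (hU i hi).1,
          (φ i).density_sideFalsifying_le _ hinit (hU i hi).2⟩)
    rw [empty_union] at h1
    rw [card_univ, card_univ, hcards] at h2
    have h3 : ((D.filter fun w => T.eval w.1 w.2 ∈
        {i | (φ i).Falsified (join A w.1 w.2)}).card : ℝ) ≤
        (correctOutside F G T.eval ∅ (univ ×ˢ univ)).card := by exact_mod_cast card_le_card hsub
    refine h3.trans (h1.trans ((add_le_add le_rfl h2).trans (le_of_eq ?_)))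
    ring
  have hfin := P.mul_card_le (fun x y => {i | (φ i).Falsified (join A x y)}) D
    (p := p) (by positivity)
    (fun w hw => hP w.1 w.2 (mem_filter.1 hw).2) (fun T hT => hdet T (hd T hT))
  have : 2 ^ n * (p / 2) ≤
      2 ^ n * ((φ.unbalanced A).card / 2 ^ Δ + τ ^ 2 * (2 * (4 * r / τ) * d + 1) + 2 ^ d * σ) := by
    refine le_trans ?_ hfin
    nlinarith
  exact le_of_mul_le_mul_left this h2n

end Formulas

/-! ### Uniform probability on finite types -/

section UniformProbability

variable {Ω Ω' : Type} [Fintype Ω] [Fintype Ω']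

theorem uniformProb_eq (E : Ω → Prop) [DecidablePred E] :
    uniformProb Ω E = ((univ.filter E).card : ℝ) / Fintype.card Ω := by
  unfold uniformProb
  congr!

theorem uniformProb_nonneg (E : Ω → Prop) : 0 ≤ uniformProb Ω E := by
  unfold uniformProb
  positivity

theorem uniformProb_mono {E E' : Ω → Prop} (h : ∀ ω, E ω → E' ω) :
    uniformProb Ω E ≤ uniformProb Ω E' := by
  classical
  unfold uniformProb
  gcongr with ω
  exact h ω

theorem uniformProb_or_le (E E' : Ω → Prop) :
    uniformProb Ω (fun ω => E ω ∨ E' ω) ≤ uniformProb Ω E + uniformProb Ω E' := by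
  classical
  rw [uniformProb_eq, uniformProb_eq, uniformProb_eq, ← add_div, filter_or]
  gcongr
  exact_mod_cast card_union_le _ _

theorem uniformProb_true [Nonempty Ω] : uniformProb Ω (fun _ => True) = 1 := by
  classical
  unfold uniformProb
  rw [filter_true, card_univ, div_self]
  exact_mod_cast Fintype.card_ne_zero

theorem uniformProb_le_one (E : Ω → Prop) : uniformProb Ω E ≤ 1 := by
  classical
  unfold uniformProb
  refine div_le_one_of_le₀ ?_ (by positivity)
  exact_mod_cast card_le_univ _

theorem one_sub_le_uniformProb [Nonempty Ω] {E B : Ω → Prop} (h : ∀ ω, ¬ B ω → E ω) :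
    1 - uniformProb Ω B ≤ uniformProb Ω E := by
  have h1 := uniformProb_mono (Ω := Ω) (E := fun _ => True) (E' := fun ω => B ω ∨ E ω)
    (fun ω _ => by have := h ω; tauto)
  have h2 := uniformProb_or_le (Ω := Ω) B E
  rw [uniformProb_true] at h1
  linarith

theorem uniformProb_fst [Nonempty Ω'] (E : Ω → Prop) :
    uniformProb (Ω × Ω') (fun ω => E ω.1) = uniformProb Ω E := by
  classical
  unfold uniformProb
  have : (univ.filter fun ω : Ω × Ω' => E ω.1) = (univ.filter E) ×ˢ univ := by
    ext ω; simp
  rw [this, card_product, Fintype.card_prod, card_univ]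
  push_cast
  rw [mul_div_mul_right]
  exact_mod_cast Fintype.card_ne_zero

theorem uniformProb_le_div_of_sum_le (f : Ω → ℝ) (hf : ∀ ω, 0 ≤ f ω) {t B : ℝ} (ht : 0 < t)
    (hB : 0 ≤ B) (h : ∑ ω, f ω ≤ B * Fintype.card Ω) :
    uniformProb Ω (fun ω => t ≤ f ω) ≤ B / t := by
  classical
  unfold uniformProb
  refine div_le_of_le_mul₀ (by positivity) (by positivity) ?_
  rw [div_mul_eq_mul_div, le_div_iff₀ ht]
  refine le_trans ?_ h
  calc ((univ.filter fun ω => t ≤ f ω).card : ℝ) * t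
      = ∑ ω, if t ≤ f ω then t else 0 := by rw [← sum_filter]; simp
    _ ≤ ∑ ω, f ω := sum_le_sum fun ω _ => by
        split_ifs with h
        · exact h
        · exact hf ω

theorem uniformProb_exists_mem_le {ι : Type} (I : Finset ι) (E : ι → Ω → Prop) {q : ℝ}
    (hq : ∀ i ∈ I, uniformProb Ω (E i) ≤ q) :
    uniformProb Ω (fun ω => ∃ i ∈ I, E i ω) ≤ I.card * q := by
  classical
  have h : uniformProb Ω (fun ω => ∃ i ∈ I, E i ω) ≤ ∑ i ∈ I, uniformProb Ω (E i) := by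
    simp only [uniformProb_eq]
    rw [← sum_div]
    gcongr
    have h : (univ.filter fun ω => ∃ i ∈ I, E i ω) ⊆ I.biUnion fun i => univ.filter (E i) := by
      intro ω hω
      simpa using hω
    exact_mod_cast (card_le_card h).trans card_biUnion_le
  refine h.trans ((sum_le_sum hq).trans (le_of_eq ?_))
  simp

/-- Independence of the coordinates of a uniformly random function. -/
theorem uniformProb_forall_mem [Nonempty Ω] {ι : Type} [Fintype ι] [DecidableEq ι] (T : Finset ι)
    (E : Ω → Prop) :
    uniformProb (ι → Ω) (fun φ => ∀ i ∈ T, E (φ i)) = uniformProb Ω E ^ T.card := by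
  classical
  rw [uniformProb_eq, uniformProb_eq]
  have h : (univ.filter fun φ : ι → Ω => ∀ i ∈ T, E (φ i)) =
      Fintype.piFinset fun i => if i ∈ T then univ.filter E else univ := by
    ext φ
    simp only [mem_filter, mem_univ, true_and, Fintype.mem_piFinset]
    refine forall_congr' fun i => ?_
    split_ifs with hi <;> simp [hi]
  have h0 : (Fintype.card Ω : ℝ) ≠ 0 := by exact_mod_cast Fintype.card_ne_zero
  rw [h, Fintype.card_piFinset, Fintype.card_fun, div_pow, div_eq_div_iff (by simp) (by simp)]
  have h2 : ∏ i : ι, (if i ∈ T then univ.filter E else (univ : Finset Ω)).card =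
      (univ.filter E).card ^ T.card * Fintype.card Ω ^ (Fintype.card ι - T.card) := by
    simp only [apply_ite Finset.card, card_univ]
    rw [prod_ite, prod_const, prod_const, filter_mem_eq_inter, univ_inter, filter_not,
      filter_mem_eq_inter, univ_inter, card_sdiff_of_subset (subset_univ T), card_univ]
  rw [h2]
  push_cast
  rw [mul_assoc, ← pow_add, Nat.sub_add_cancel (card_le_univ T)]

end UniformProbability

/-! ### Random clauses: satisfying assignments and expansion -/

section RandomClauses

variable {m n Δ : ℕ}

theorem card_sigma_filter_fst (Q : {s : Finset (Fin n) // s.card = Δ} → Prop) [DecidablePred Q] :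
    (univ.filter fun C : Clause n Δ => Q C.1).card = (univ.filter Q).card * 2 ^ Δ := by
  have : (univ.filter fun C : Clause n Δ => Q C.1) = (univ.filter Q).sigma fun _ => univ := by
    ext C; simp
  rw [this, card_sigma, sum_const_nat]
  intro s _
  rw [card_univ, Fintype.card_fun, Fintype.card_bool, Fintype.card_coe, s.2]

theorem card_subsets_of (V : Finset (Fin n)) :
    (univ.filter fun s : {s : Finset (Fin n) // s.card = Δ} => s.1 ⊆ V).card =
      V.card.choose Δ := by
  rw [← card_powersetCard, ← card_map (Function.Embedding.subtype _)]
  congr 1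
  ext s
  simp [mem_powersetCard, and_comm]

theorem card_clause : Fintype.card (Clause n Δ) = n.choose Δ * 2 ^ Δ := by
  have h1 := card_sigma_filter_fst (n := n) (Δ := Δ) fun s => s.1 ⊆ univ
  rw [card_subsets_of] at h1
  simpa using h1

theorem nonempty_clause (h : Δ ≤ n) : Nonempty (Clause n Δ) := by
  rw [← Fintype.card_pos_iff, card_clause]
  have := Nat.choose_pos h
  positivity

/-- Factor by factor, `(v - k) / (n - k) ≤ v / n`: drawing without replacement is less likely to
stay in a `v`-set than drawing with replacement. -/
theorem choose_mul_pow_le {v n : ℕ} (h : v ≤ n) (k : ℕ) :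
    v.choose k * n ^ k ≤ v ^ k * n.choose k := by
  have hd : v.descFactorial k * n ^ k ≤ v ^ k * n.descFactorial k := by
    induction k with
    | zero => simp
    | succ k ih =>
      rw [Nat.descFactorial_succ, Nat.descFactorial_succ, pow_succ, pow_succ]
      have h1 : (v - k) * n ≤ v * (n - k) := by
        rw [Nat.sub_mul, Nat.mul_sub]
        have : v * k ≤ k * n := by rw [mul_comm v k]; exact Nat.mul_le_mul_left _ h
        omega
      calc (v - k) * v.descFactorial k * (n ^ k * n)
          = (v.descFactorial k * n ^ k) * ((v - k) * n) := by ring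
        _ ≤ (v ^ k * n.descFactorial k) * (v * (n - k)) := Nat.mul_le_mul ih h1
        _ = _ := by ring
  rw [Nat.descFactorial_eq_factorial_mul_choose, Nat.descFactorial_eq_factorial_mul_choose] at hd
  refine Nat.le_of_mul_le_mul_left (c := k.factorial) ?_ k.factorial_pos
  nlinarith

theorem uniformProb_vars_subset_le (hΔ : Δ ≤ n) (V : Finset (Fin n)) :
    uniformProb (Clause n Δ) (fun C => C.vars ⊆ V) ≤ ((V.card : ℝ) / n) ^ Δ := by
  classical
  have h1 := card_sigma_filter_fst (n := n) (Δ := Δ) fun s => s.1 ⊆ V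
  rw [card_subsets_of] at h1
  have h2 : (univ.filter fun C : Clause n Δ => C.vars ⊆ V).card = V.card.choose Δ * 2 ^ Δ := by
    rw [← h1]; rfl
  have h3 := choose_mul_pow_le (card_le_univ V) Δ
  rw [Fintype.card_fin] at h3
  have h4 : (0 : ℝ) < n.choose Δ := by exact_mod_cast Nat.choose_pos hΔ
  rcases Nat.eq_zero_or_pos n with rfl | hn
  · obtain rfl : Δ = 0 := by omega
    simpa using uniformProb_le_one _
  · have hn' : (0 : ℝ) < n := by exact_mod_cast hn
    rw [uniformProb_eq, h2, card_clause, div_pow]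
    push_cast
    rw [mul_div_mul_right _ _ (by positivity), div_le_div_iff₀ h4 (by positivity)]
    exact_mod_cast h3

theorem uniformProb_not_falsified_le (hΔ : Δ ≤ n) (z : Fin n → Bool) :
    uniformProb (Clause n Δ) (fun C => ¬ C.Falsified z) ≤ 1 - 1 / 2 ^ Δ := by
  classical
  -- For each set of variables, the signs opposite to `z` give a falsified clause.
  have h1 : n.choose Δ ≤ (univ.filter fun C : Clause n Δ => C.Falsified z).card := by
    have h2 := card_subsets_of (n := n) (Δ := Δ) univ
    rw [card_univ, Fintype.card_fin] at h2
    rw [← h2]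
    refine card_le_card_of_injOn (fun s => (⟨s, fun j => !z j.1⟩ : Clause n Δ)) ?_ ?_
    · intro s _
      simp [Clause.Falsified]
    · intro s _ s' _ h
      exact (Sigma.mk.inj h).1
  have h2 : (univ.filter fun C : Clause n Δ => C.Falsified z).card +
      (univ.filter fun C : Clause n Δ => ¬ C.Falsified z).card = n.choose Δ * 2 ^ Δ := by
    rw [← card_clause, ← card_univ]
    exact card_filter_add_card_filter_not _
  have h3 : ((univ.filter fun C : Clause n Δ => ¬ C.Falsified z).card : ℝ) ≤
      n.choose Δ * 2 ^ Δ - n.choose Δ := by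
    have h1' : (n.choose Δ : ℝ) ≤ (univ.filter fun C : Clause n Δ => C.Falsified z).card := by
      exact_mod_cast h1
    have h2' : ((univ.filter fun C : Clause n Δ => C.Falsified z).card : ℝ) +
      (univ.filter fun C : Clause n Δ => ¬ C.Falsified z).card = n.choose Δ * 2 ^ Δ := by
      exact_mod_cast h2
    linarith
  have h4 : (0 : ℝ) < n.choose Δ := by exact_mod_cast Nat.choose_pos hΔ
  rw [uniformProb_eq, card_clause]
  push_cast
  rw [div_le_iff₀ (by positivity)]
  refine h3.trans (le_of_eq ?_)
  field_simp

theorem sum_numSat_le (hΔ : Δ ≤ n) : ∑ φ : Formula m n Δ, (φ.numSat : ℝ) ≤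
    (2 ^ n * (1 - 1 / 2 ^ Δ) ^ m) * Fintype.card (Formula m n Δ) := by
  classical
  have := nonempty_clause hΔ
  have h0 : (0 : ℝ) < Fintype.card (Formula m n Δ) := by exact_mod_cast Fintype.card_pos
  have h1 : ∑ φ : Formula m n Δ, φ.numSat =
      ∑ z : Fin n → Bool, (univ.filter fun φ : Formula m n Δ => ∀ i, ¬ (φ i).Falsified z).card := by
    have h := sum_card_bipartiteAbove_eq_sum_card_bipartiteBelow (s := univ) (t := univ)
      (fun (φ : Formula m n Δ) (z : Fin n → Bool) => ∀ i, ¬ (φ i).Falsified z)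
    simp only [bipartiteAbove, bipartiteBelow] at h
    rw [← h]
    refine sum_congr rfl fun φ _ => ?_
    unfold Formula.numSat
    congr! 2
  have h2 (z : Fin n → Bool) :
      ((univ.filter fun φ : Formula m n Δ => ∀ i, ¬ (φ i).Falsified z).card : ℝ) ≤
        (1 - 1 / 2 ^ Δ) ^ m * Fintype.card (Formula m n Δ) := by
    have h3 := uniformProb_forall_mem (ι := Fin m) univ fun C : Clause n Δ => ¬ C.Falsified z
    have h4 : uniformProb (Clause n Δ) (fun C => ¬ C.Falsified z) ^ m ≤ (1 - 1 / 2 ^ Δ) ^ m :=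
      pow_le_pow_left₀ (uniformProb_nonneg _) (uniformProb_not_falsified_le hΔ z) m
    rw [card_univ, Fintype.card_fin] at h3
    rw [← h3] at h4
    simp only [mem_univ, true_imp_iff] at h4
    rwa [uniformProb_eq, div_le_iff₀ (by exact_mod_cast Fintype.card_pos)] at h4
  have h5 : ∑ φ : Formula m n Δ, (φ.numSat : ℝ) = ∑ z : Fin n → Bool,
      ((univ.filter fun φ : Formula m n Δ => ∀ i, ¬ (φ i).Falsified z).card : ℝ) := by
    exact_mod_cast h1
  rw [h5]
  refine (sum_le_sum fun z _ => h2 z).trans (le_of_eq ?_)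
  rw [sum_const, card_univ, Fintype.card_fun, Fintype.card_bool, Fintype.card_fin, nsmul_eq_mul]
  push_cast
  ring

/-- First moment bound on the number of satisfying assignments. -/
theorem uniformProb_le_numSat (hΔ : Δ ≤ n) {t : ℝ} (ht : 0 < t) :
    uniformProb (Formula m n Δ) (fun φ => t ≤ φ.numSat) ≤
      2 ^ n * Real.exp (-(m / 2 ^ Δ)) / t := by
  have h1 : (1 - 1 / 2 ^ Δ : ℝ) ^ m ≤ Real.exp (-(m / 2 ^ Δ)) := by
    have h2 : (1 - 1 / 2 ^ Δ : ℝ) ≤ Real.exp (-(1 / 2 ^ Δ)) := by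
      have := Real.add_one_le_exp (-(1 / 2 ^ Δ : ℝ)); linarith
    have h3 : (0 : ℝ) ≤ 1 - 1 / 2 ^ Δ := by
      rw [sub_nonneg, div_le_one (by positivity)]; exact one_le_pow₀ (by norm_num)
    refine (pow_le_pow_left₀ h3 h2 m).trans (le_of_eq ?_)
    rw [← Real.exp_nat_mul]; ring_nf
  refine uniformProb_le_div_of_sum_le _ (fun φ => by positivity) ht (by positivity)
    ((sum_numSat_le hΔ).trans ?_)
  gcongr

/-- Union bound over the `r` clauses that fail to expand and over a set `V` of `7 * (r * Δ) / 8`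
variables containing all of theirs. -/
theorem uniformProb_not_expands_le (hΔ : Δ ≤ n) (r : ℕ) (hv : 7 * (r * Δ) / 8 ≤ n) :
    uniformProb (Formula m n Δ) (fun φ => ¬ φ.Expands r) ≤
      m.choose r * (n.choose (7 * (r * Δ) / 8) *
        (((7 * (r * Δ) / 8 : ℕ) : ℝ) / n) ^ (r * Δ)) := by
  classical
  have := nonempty_clause hΔ
  set v := 7 * (r * Δ) / 8
  have hT : ∀ T ∈ powersetCard r (univ : Finset (Fin m)), ∀ V ∈ powersetCard v univ,
      uniformProb (Formula m n Δ) (fun φ => ∀ i ∈ T, (φ i).vars ⊆ V) ≤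
        ((v : ℝ) / n) ^ (r * Δ) := by
    intro T hT V hV
    rw [mem_powersetCard] at hT hV
    have h1 := uniformProb_forall_mem T fun C : Clause n Δ => C.vars ⊆ V
    have h2 := uniformProb_vars_subset_le hΔ V
    rw [hV.2] at h2
    rw [hT.2] at h1
    rw [h1, mul_comm, pow_mul]
    exact pow_le_pow_left₀ (uniformProb_nonneg _) h2 r
  have h1 := uniformProb_exists_mem_le (powersetCard r (univ : Finset (Fin m)))
    (fun T (φ : Formula m n Δ) => ∃ V ∈ powersetCard v univ, ∀ i ∈ T, (φ i).vars ⊆ V)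
    (fun T hTr => uniformProb_exists_mem_le _ _ (hT T hTr))
  simp only [card_powersetCard, card_univ, Fintype.card_fin] at h1
  refine le_trans (uniformProb_mono fun φ hφ => ?_) h1
  unfold Formula.Expands at hφ
  push Not at hφ
  obtain ⟨T, hTr, hlt⟩ := hφ
  refine ⟨T, mem_powersetCard.2 ⟨subset_univ _, hTr⟩, ?_⟩
  have hle : (T.biUnion fun i => (φ i).vars).card ≤ v := by omega
  obtain ⟨V, hsub, -, hV⟩ := exists_subsuperset_card_eq
    (subset_univ (T.biUnion fun i => (φ i).vars)) hle (by simpa using hv)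
  exact ⟨V, mem_powersetCard.2 ⟨subset_univ _, hV⟩,
    fun i hi => (subset_biUnion_of_mem (fun i => (φ i).vars) hi).trans hsub⟩

end RandomClauses

/-! ### Random splits: unbalanced clauses are rare -/

section RandomSplit

variable {m n Δ : ℕ}

/-- The moment generating function of a binomial variable, read off from expanding a product over
all variables. -/
theorem sum_pow_card_filter_mem (V : Finset (Fin n)) (t : ℝ) :
    ∑ A : Finset (Fin n), t ^ (V.filter (· ∈ A)).card * 2 ^ V.card = 2 ^ n * (1 + t) ^ V.card := by
  have h1 := prod_one_add (f := fun j : Fin n => if j ∈ V then t else 1) (s := univ)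
  rw [powerset_univ] at h1
  have h2 (A : Finset (Fin n)) : ∏ j ∈ A, (if j ∈ V then t else 1) =
      t ^ (V.filter (· ∈ A)).card := by
    rw [prod_ite, prod_const, prod_const_one, mul_one]
    congr 2
    ext j; simp [and_comm]
  have h3 : ∏ j : Fin n, (1 + if j ∈ V then t else 1) = (1 + t) ^ V.card * 2 ^ (n - V.card) := by
    have : ∀ j : Fin n, (1 + if j ∈ V then t else 1) = if j ∈ V then 1 + t else 2 := by
      intro j; split_ifs <;> norm_num
    simp only [this]
    rw [prod_ite, prod_const, prod_const, filter_mem_eq_inter, univ_inter, filter_not,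
      filter_mem_eq_inter, univ_inter, card_sdiff_of_subset (subset_univ V), card_univ,
      Fintype.card_fin]
  simp only [h2, h3] at h1
  rw [← sum_mul, ← h1, mul_assoc, ← pow_add, Nat.sub_add_cancel, mul_comm]
  simpa using card_le_univ V

theorem card_few_mem_le (V : Finset (Fin n)) :
    ((univ.filter fun A : Finset (Fin n) => 4 * (V.filter (· ∈ A)).card < V.card).card : ℝ) ≤
      2 ^ n * (9 / 10) ^ V.card := by
  -- Chernoff bound. The choice `t = (3 / 4) ^ 4` makes `t ^ (-1 / 4) = 4 / 3` rational, and the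
  -- resulting base `(4 / 3) * (1 + t) / 2` is below `9 / 10`.
  have h1 := sum_pow_card_filter_mem V (81 / 256)
  have h2 : ((univ.filter fun A : Finset (Fin n) =>
      4 * (V.filter (· ∈ A)).card < V.card).card : ℝ) * 2 ^ V.card ≤
      (4 / 3) ^ V.card * (2 ^ n * (1 + 81 / 256) ^ V.card) := by
    rw [← h1, mul_sum, ← nsmul_eq_mul, ← sum_const, sum_filter]
    refine sum_le_sum fun A _ => ?_
    split_ifs with h
    · rw [← mul_assoc]
      refine le_mul_of_one_le_left (by positivity) ?_
      have : (81 / 256 : ℝ) = ((4 / 3) ^ 4)⁻¹ := by norm_num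
      rw [this, inv_pow, ← pow_mul, ← div_eq_mul_inv, one_le_div (by positivity)]
      exact pow_le_pow_right₀ (by norm_num) h.le
    · positivity
  have h3 : (4 / 3 : ℝ) ^ V.card * (2 ^ n * (1 + 81 / 256) ^ V.card) ≤
      2 ^ n * (9 / 10) ^ V.card * 2 ^ V.card := by
    rw [mul_left_comm, ← mul_pow, mul_assoc, ← mul_pow]
    exact mul_le_mul_of_nonneg_left (pow_le_pow_left₀ (by norm_num) (by norm_num) _)
      (by positivity)
  exact le_of_mul_le_mul_right (h2.trans h3) (by positivity)

theorem card_few_not_mem_le (V : Finset (Fin n)) :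
    ((univ.filter fun A : Finset (Fin n) => 4 * (V.filter (· ∉ A)).card < V.card).card : ℝ) ≤
      2 ^ n * (9 / 10) ^ V.card := by
  refine le_trans ?_ (card_few_mem_le V)
  have : (univ.filter fun A : Finset (Fin n) => 4 * (V.filter (· ∉ A)).card < V.card).card ≤
      (univ.filter fun A : Finset (Fin n) => 4 * (V.filter (· ∈ A)).card < V.card).card := by
    refine card_le_card_of_injOn compl ?_ compl_injective.injOn
    intro A hA
    simpa using hA
  exact_mod_cast this

theorem Formula.sum_card_unbalanced_le (φ : Formula m n Δ) :
    ∑ A : Finset (Fin n), ((φ.unbalanced A).card : ℝ) ≤ m * (2 * (9 / 10) ^ Δ) * 2 ^ n := by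
  have h := sum_card_bipartiteAbove_eq_sum_card_bipartiteBelow (s := univ) (t := univ)
    (fun (A : Finset (Fin n)) (i : Fin m) => 4 * ((φ i).vars.filter (· ∈ A)).card < Δ ∨
    4 * ((φ i).vars.filter (· ∉ A)).card < Δ)
  have h' : ∑ A : Finset (Fin n), ((φ.unbalanced A).card : ℝ) = ∑ i : Fin m,
      ((univ.filter fun A : Finset (Fin n) => 4 * ((φ i).vars.filter (· ∈ A)).card < Δ ∨
        4 * ((φ i).vars.filter (· ∉ A)).card < Δ).card : ℝ) := by exact_mod_cast h
  rw [h']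
  calc _ ≤ ∑ _i : Fin m, (2 ^ n * (9 / 10) ^ Δ + 2 ^ n * (9 / 10) ^ Δ : ℝ) := by
        refine sum_le_sum fun i _ => ?_
        have h1 := card_few_mem_le (φ i).vars
        have h2 := card_few_not_mem_le (φ i).vars
        simp only [(φ i).card_vars] at h1 h2
        refine le_trans ?_ (add_le_add h1 h2)
        rw [filter_or]
        exact_mod_cast card_union_le _ _
    _ = _ := by rw [sum_const, card_univ, Fintype.card_fin, nsmul_eq_mul]; ring

theorem uniformProb_le_card_unbalanced {t : ℝ} (ht : 0 < t) :
    uniformProb (Formula m n Δ × Finset (Fin n)) (fun ω => t ≤ (ω.1.unbalanced ω.2).card) ≤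
      m * (2 * (9 / 10) ^ Δ) / t := by
  refine uniformProb_le_div_of_sum_le _ (fun ω => by positivity) ht (by positivity) ?_
  rw [Fintype.sum_prod_type, Fintype.card_prod, Fintype.card_finset, Fintype.card_fin]
  refine (sum_le_sum fun φ _ => φ.sum_card_unbalanced_le).trans (le_of_eq ?_)
  rw [sum_const, card_univ, nsmul_eq_mul]
  push_cast
  ring

end RandomSplit

/-! ### Numerical estimates and the choice of parameters -/

section Estimates

/-- With `N = r * Δ` and `v = 7 * N / 8`, the choice of clauses costs `4 ^ N` and that of variables,
against `v` of the `N` factors `v / n`, at most `exp v ≤ 4 ^ N`. The remaining `N - v ≥ N / 8`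
factors are at most `2 ^ (-40)` each and gain `2 ^ (-5 * N)`; this is the source of the constant `2
^ 40`. -/
theorem choose_mul_choose_mul_pow_le {m n r Δ : ℕ} (hn : 0 < n) (hm : (m : ℝ) ≤ 4 ^ Δ)
    (hr : r * Δ * 2 ^ 40 ≤ n) :
    (m.choose r : ℝ) * (n.choose (7 * (r * Δ) / 8) *
        (((7 * (r * Δ) / 8 : ℕ) : ℝ) / n) ^ (r * Δ)) ≤ (1 / 2) ^ (r * Δ) := by
  set N := r * Δ with hN
  set v := 7 * N / 8 with hv
  have hvN : v ≤ N := by omega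
  have hn' : (0 : ℝ) < n := by exact_mod_cast hn
  have h1 : (m.choose r : ℝ) ≤ 4 ^ N := by
    calc (m.choose r : ℝ) ≤ (m : ℝ) ^ r := by exact_mod_cast Nat.choose_le_pow m r
      _ ≤ (4 ^ Δ) ^ r := pow_le_pow_left₀ (by positivity) hm r
      _ = 4 ^ N := by rw [← pow_mul, hN, mul_comm]
  have h2 : (n.choose v : ℝ) * ((v : ℝ) / n) ^ v ≤ 4 ^ N := by
    calc (n.choose v : ℝ) * ((v : ℝ) / n) ^ v
        ≤ (n : ℝ) ^ v / v.factorial * ((v : ℝ) / n) ^ v := by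
          gcongr; exact Nat.choose_le_pow_div v n
      _ = (v : ℝ) ^ v / v.factorial := by
          rw [div_pow]; field_simp
      _ ≤ Real.exp v := Real.pow_div_factorial_le_exp _ (by positivity) _
      _ = Real.exp 1 ^ v := by rw [← Real.exp_nat_mul, mul_one]
      _ ≤ 4 ^ v := pow_le_pow_left₀ (Real.exp_pos _).le
          (by have := Real.exp_one_lt_d9; linarith) v
      _ ≤ 4 ^ N := pow_le_pow_right₀ (by norm_num) hvN
  have h3 : ((v : ℝ) / n) ^ (N - v) ≤ (1 / 2) ^ (5 * N) := by
    have h4 : (v : ℝ) / n ≤ (1 / 2) ^ 40 := by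
      rw [div_le_iff₀ hn']
      have : (v * 2 ^ 40 : ℝ) ≤ n := by
        exact_mod_cast (Nat.mul_le_mul_right _ hvN).trans hr
      norm_num at this ⊢
      linarith
    calc ((v : ℝ) / n) ^ (N - v) ≤ ((1 / 2) ^ 40) ^ (N - v) :=
          pow_le_pow_left₀ (by positivity) h4 _
      _ = (1 / 2) ^ (40 * (N - v)) := by rw [← pow_mul]
      _ ≤ (1 / 2) ^ (5 * N) := pow_le_pow_of_le_one (by norm_num) (by norm_num) (by omega)
  calc (m.choose r : ℝ) * (n.choose v * ((v : ℝ) / n) ^ N)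
      = m.choose r * ((n.choose v * ((v : ℝ) / n) ^ v) * ((v : ℝ) / n) ^ (N - v)) := by
        rw [mul_assoc (n.choose v : ℝ), ← pow_add, Nat.add_sub_cancel' hvN]
    _ ≤ 4 ^ N * (4 ^ N * (1 / 2) ^ (5 * N)) := by gcongr
    _ = (1 / 2) ^ N := by
        rw [pow_mul (1 / 2 : ℝ) 5 N, ← mul_pow (4 : ℝ), ← mul_pow (4 : ℝ)]; norm_num

theorem pow_three_le_two_pow {n Δ w : ℕ} (hn : 2 ≤ n) (h : (n : ℝ) ^ 40 ≤ 2 * 2 ^ Δ)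
    (hw : Δ ≤ 4 * w) : (n : ℝ) ^ 3 ≤ 2 ^ w := by
  have hn' : (2 : ℝ) ≤ n := by exact_mod_cast hn
  have h1 : ((n : ℝ) ^ 10) ^ 4 ≤ (2 * 2 ^ w) ^ 4 := by
    calc ((n : ℝ) ^ 10) ^ 4 = (n : ℝ) ^ 40 := by ring
      _ ≤ 2 * 2 ^ Δ := h
      _ ≤ 2 * 2 ^ (4 * w) := by gcongr; norm_num
      _ ≤ 16 * 2 ^ (4 * w) := by gcongr; norm_num
      _ = (2 * 2 ^ w) ^ 4 := by rw [mul_pow, ← pow_mul, mul_comm w 4]; norm_num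
  have h2 := le_of_pow_le_pow_left₀ (by norm_num) (by positivity) h1
  have h3 : (2 : ℝ) ≤ n ^ 7 := by
    calc (2 : ℝ) ≤ n ^ 1 := by simpa using hn'
      _ ≤ n ^ 7 := pow_le_pow_right₀ (by linarith) (by norm_num)
  have h4 : 2 * (n : ℝ) ^ 3 ≤ n ^ 10 := by
    calc 2 * (n : ℝ) ^ 3 ≤ (n : ℝ) ^ 7 * (n : ℝ) ^ 3 := by gcongr
      _ = (n : ℝ) ^ 10 := by ring
  linarith

theorem nine_tenths_pow_le {n Δ : ℕ} (hn : 1 ≤ n) (h : (n : ℝ) ^ 40 ≤ 2 * 2 ^ Δ) :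
    (9 / 10 : ℝ) ^ Δ ≤ 2 / n ^ 4 := by
  have hn' : (0 : ℝ) < n := by exact_mod_cast hn
  have h1 : ((9 / 10 : ℝ) ^ Δ) ^ 10 ≤ (2 / n ^ 4) ^ 10 := by
    calc ((9 / 10 : ℝ) ^ Δ) ^ 10 = ((9 / 10 : ℝ) ^ 10) ^ Δ := by
          rw [← pow_mul, ← pow_mul, mul_comm]
      _ ≤ (1 / 2) ^ Δ := pow_le_pow_left₀ (by norm_num) (by norm_num) _
      _ = 1 / 2 ^ Δ := by rw [div_pow, one_pow]
      _ ≤ 2 / n ^ 40 := by rw [div_le_div_iff₀ (by positivity) (by positivity)]; linarith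
      _ ≤ 2 ^ 10 / n ^ 40 := by gcongr; norm_num
      _ = (2 / n ^ 4) ^ 10 := by rw [div_pow, ← pow_mul]
  exact le_of_pow_le_pow_left₀ (by norm_num) (by positivity) h1

/-- The hypotheses give `2 ^ e ≥ (n ^ 5 / 2) ^ r`: the exponent 40 divided by the 8 from expansion.
This beats `τ ^ r = n ^ (-3 * r)` and leaves `(n ^ 2 / 8) ^ r`. -/
theorem pow_le_mul_two_pow {n Δ r e : ℕ} (hn : 8 ≤ n) (h : (n : ℝ) ^ 40 ≤ 2 * 2 ^ Δ)
    (he : r * Δ ≤ 8 * e) : (n : ℝ) ^ r ≤ (((n : ℝ) ^ 3)⁻¹ / 4) ^ r * 2 ^ e := by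
  have hn' : (8 : ℝ) ≤ n := by exact_mod_cast hn
  have h0 : (0 : ℝ) < n := by linarith
  have h1 : (((n : ℝ) ^ 5 / 2) ^ r) ^ 8 ≤ (2 ^ e) ^ 8 := by
    calc (((n : ℝ) ^ 5 / 2) ^ r) ^ 8 = ((n : ℝ) ^ 40 / 256) ^ r := by
          rw [← pow_mul, mul_comm r 8, pow_mul, div_pow, ← pow_mul]; norm_num
      _ ≤ (2 ^ Δ) ^ r := by
          refine pow_le_pow_left₀ (by positivity) ?_ r
          have : (0 : ℝ) < 2 ^ Δ := by positivity
          linarith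
      _ = 2 ^ (r * Δ) := by rw [← pow_mul, mul_comm]
      _ ≤ 2 ^ (8 * e) := pow_le_pow_right₀ (by norm_num) he
      _ = (2 ^ e) ^ 8 := by rw [← pow_mul, mul_comm]
  have h2 := le_of_pow_le_pow_left₀ (by norm_num) (by positivity) h1
  calc (n : ℝ) ^ r ≤ (((n : ℝ) ^ 3)⁻¹ / 4 * ((n : ℝ) ^ 5 / 2)) ^ r := by
        refine pow_le_pow_left₀ h0.le ?_ r
        have : ((n : ℝ) ^ 3)⁻¹ / 4 * ((n : ℝ) ^ 5 / 2) = n ^ 2 / 8 := by field_simp; norm_num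
        rw [this]
        nlinarith
    _ ≤ _ := by rw [mul_pow]; gcongr

/-- Numerical conditions under which the lower bound holds for every good formula and split. -/
structure Regime (c κ p : ℝ) (n Δ : ℕ) : Prop where
  eight_le : 8 ≤ n
  width_le : Δ * 2 ^ 40 ≤ n
  width_pos : 0 < Δ
  pow_le : (n : ℝ) ^ 40 ≤ 2 * 2 ^ Δ
  width_le_log : (Δ : ℝ) ≤ 2 * c * Real.logb 2 n
  log_le : 1 + 4 * Real.logb 2 n < 2 * κ * n
  error_lt : 9 / (n : ℝ) + 2 ^ (-(κ * n)) < p / 4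

theorem Regime.randCommAtLeast {c κ p : ℝ} {m n Δ : ℕ} (h : Regime c κ p n Δ) (hc : 40 ≤ c)
    (hκ : κ = 1 / (8 * c * 2 ^ 40)) (hp : 0 < p) {φ : Formula m n Δ} {A : Finset (Fin n)}
    (hφ : φ.Expands (n / (Δ * 2 ^ 40))) (hsat : 2 * (φ.numSat : ℝ) ≤ 2 ^ n)
    (hA : ((φ.unbalanced A).card : ℝ) ≤ p / 4 * 2 ^ Δ) : RandCommAtLeast φ A p (κ * n) := by
  intro P d hd hP
  by_contra hlt
  rw [not_le] at hlt
  set r := n / (Δ * 2 ^ 40) with hr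
  set L := Real.logb 2 n with hL
  have hn8 : (8 : ℝ) ≤ n := by exact_mod_cast h.eight_le
  have hn0 : (0 : ℝ) < n := by linarith
  have hL0 : 0 < L := Real.logb_pos (by norm_num) (by linarith)
  have hΔ0 : (0 : ℝ) < Δ := by exact_mod_cast h.width_pos
  have hκ0 : 0 < κ := by rw [hκ]; positivity
  have hr0 : 0 < r := Nat.div_pos h.width_le (by have := h.width_pos; positivity)
  have hpow (k : ℕ) : (n : ℝ) ^ k = 2 ^ (k * L) := by
    rw [mul_comm, Real.rpow_mul (by norm_num), Real.rpow_logb (by norm_num) (by norm_num) hn0,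
      Real.rpow_natCast]
  -- `r` is `n / (Δ * 2 ^ 40)` rounded down and `Δ ≤ 2 * c * L`, so `(r + 1) * L ≥ n / (2 * c * 2 ^
  -- 40) = 4 * κ * n`. Thus `n ^ r` outweighs `σ⁻¹ = 2 ^ (2 * κ * n)` with room for polynomial
  -- factors.
  have hrL : 4 * κ * n - L ≤ r * L := by
    have h1 : (n : ℝ) < (r + 1) * (Δ * 2 ^ 40) := by
      have := Nat.lt_div_mul_add (a := n) (b := Δ * 2 ^ 40) (by have := h.width_pos; positivity)
      rw [← hr] at this
      have h2 : (n : ℝ) < r * (Δ * 2 ^ 40) + Δ * 2 ^ 40 := by exact_mod_cast this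
      linarith
    have h2 : (n : ℝ) ≤ (r + 1) * (2 * c * L * 2 ^ 40) := by
      refine h1.le.trans ?_
      gcongr
      exact h.width_le_log
    have h3 : 4 * κ * n ≤ (r + 1) * L := by
      rw [hκ]
      have : 4 * (1 / (8 * c * 2 ^ 40)) * (n : ℝ) = n / (2 * c * 2 ^ 40) := by
        field_simp; norm_num
      rw [this, div_le_iff₀ (by positivity)]
      linarith
    linarith
  have hτ : (0 : ℝ) < ((n : ℝ) ^ 3)⁻¹ := by positivity
  have hσ : (0 : ℝ) < 2 ^ (-(2 * κ * n)) := by positivity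
  have hkey := hφ.success_le A hτ hσ.le hp.le hr0 (fun e he => by
      have h1 := pow_le_mul_two_pow h.eight_le h.pow_le he
      have h2 : 2 * (n : ℝ) ^ 3 < 2 ^ (-(2 * κ * n)) * n ^ r := by
        rw [hpow, hpow, ← Real.rpow_add (by norm_num)]
        calc (2 : ℝ) * 2 ^ ((3 : ℕ) * L) = 2 ^ (1 + (3 : ℕ) * L) := by
              rw [Real.rpow_add (by norm_num), Real.rpow_one]
          _ < _ := by
              refine Real.rpow_lt_rpow_of_exponent_lt (by norm_num) ?_
              have := h.log_le
              push_cast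
              linarith
      have h3 : 2 * (n : ℝ) ^ 3 < 2 ^ (-(2 * κ * n)) * ((((n : ℝ) ^ 3)⁻¹ / 4) ^ r * 2 ^ e) :=
        h2.trans_le (mul_le_mul_of_nonneg_left h1 hσ.le)
      calc (1 : ℝ) = ((n : ℝ) ^ 3)⁻¹ / 2 * (2 * (n : ℝ) ^ 3) := by field_simp
        _ < ((n : ℝ) ^ 3)⁻¹ / 2 *
            (2 ^ (-(2 * κ * n)) * ((((n : ℝ) ^ 3)⁻¹ / 4) ^ r * 2 ^ e)) := by gcongr
        _ = _ := by ring)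
    (fun w hw => by
      rw [inv_mul_eq_div, one_le_div (by positivity)]
      exact pow_three_le_two_pow (by have := h.eight_le; omega) h.pow_le hw) hsat P hd hP
  have hU : ((φ.unbalanced A).card : ℝ) / 2 ^ Δ ≤ p / 4 := by
    rw [div_le_iff₀ (by positivity)]; exact hA
  have hdn : (d : ℝ) ≤ n := by
    have : κ ≤ 1 := by
      rw [hκ, div_le_one (by positivity)]; linarith
    nlinarith
  have hrn : (r : ℝ) ≤ n := by exact_mod_cast Nat.div_le_self _ _
  -- With `r, d ≤ n` and `τ = n ^ (-3)`, the term with `M` is at most `8 / n`; bounding the summand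
  -- 1 by `n ^ 5` contributes the ninth.
  have hM : ((n : ℝ) ^ 3)⁻¹ ^ 2 * (2 * (4 * r / ((n : ℝ) ^ 3)⁻¹) * d + 1) ≤ 9 / n := by
    calc ((n : ℝ) ^ 3)⁻¹ ^ 2 * (2 * (4 * r / ((n : ℝ) ^ 3)⁻¹) * d + 1)
        ≤ ((n : ℝ) ^ 3)⁻¹ ^ 2 * (2 * (4 * (n : ℝ) / ((n : ℝ) ^ 3)⁻¹) * n + (n : ℝ) ^ 5) := by
          gcongr
          exact one_le_pow₀ (by linarith)
      _ = 9 / (n : ℝ) := by field_simp; norm_num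
  have hd2 : (2 : ℝ) ^ d * 2 ^ (-(2 * κ * n)) ≤ 2 ^ (-(κ * n)) := by
    rw [← Real.rpow_natCast, ← Real.rpow_add (by norm_num)]
    exact Real.rpow_le_rpow_of_exponent_le (by norm_num) (by linarith)
  have := h.error_lt
  linarith

theorem Regime.eventually {c κ p : ℝ} (hc : 40 ≤ c) (hκ : 0 < κ) (hp : 0 < p) {Δ : ℕ → ℕ}
    (hΔ : ∀ᶠ n : ℕ in atTop, |(Δ n : ℝ) - c * Real.logb 2 (n : ℝ)| ≤ 1) :
    ∀ᶠ n : ℕ in atTop, Regime c κ p n (Δ n) := by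
  have hcast : Tendsto (fun n : ℕ => (n : ℝ)) atTop atTop := tendsto_natCast_atTop_atTop
  have hlogb : (fun n : ℕ => Real.logb 2 (n : ℝ)) =o[atTop] fun n : ℕ => (n : ℝ) := by
    have h := (Real.isLittleO_log_id_atTop.const_mul_left (Real.log 2)⁻¹).comp_tendsto hcast
    refine h.congr (fun n => ?_) fun n => rfl
    simp [Real.logb, div_eq_inv_mul]
  have hsmall (ε : ℝ) (hε : 0 < ε) : ∀ᶠ n : ℕ in atTop, Real.logb 2 (n : ℝ) ≤ ε * n := by
    filter_upwards [hlogb.bound hε] with n hn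
    rw [Real.norm_of_nonneg (Nat.cast_nonneg n)] at hn
    exact (le_abs_self _).trans hn
  have hL : Tendsto (fun n : ℕ => Real.logb 2 (n : ℝ)) atTop atTop :=
    (Real.tendsto_logb_atTop (by norm_num)).comp hcast
  have herr : Tendsto (fun n : ℕ => 9 / (n : ℝ) + 2 ^ (-(κ * n))) atTop (𝓝 0) := by
    have h1 : Tendsto (fun n : ℕ => 9 / (n : ℝ)) atTop (𝓝 0) :=
      tendsto_const_div_atTop_nhds_zero_nat 9
    have h2 : Tendsto (fun n : ℕ => (2 : ℝ) ^ (-(κ * n))) atTop (𝓝 0) := by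
      have h3 : Tendsto (fun n : ℕ => Real.exp (-(Real.log 2 * κ * n))) atTop (𝓝 0) :=
        Real.tendsto_exp_neg_atTop_nhds_zero.comp
          (hcast.const_mul_atTop (mul_pos (Real.log_pos (by norm_num)) hκ))
      refine h3.congr fun n => ?_
      rw [Real.rpow_def_of_pos (by norm_num)]
      ring_nf
    simpa using h1.add h2
  filter_upwards [hΔ, eventually_ge_atTop 8, hL.eventually_ge_atTop 1,
    hsmall (κ / 4) (by positivity), hsmall (1 / (2 * c * 2 ^ 40)) (by positivity),
    (hcast.const_mul_atTop hκ).eventually_gt_atTop 1,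
    herr.eventually_lt_const (by positivity : (0 : ℝ) < p / 4)] with n h1 h2 h3 h4 h5 h6 h7
  have hn0 : (0 : ℝ) < n := by
    have : (8 : ℝ) ≤ n := by exact_mod_cast h2
    linarith
  obtain ⟨h8, h9⟩ := abs_le.mp h1
  -- Rounding costs at most 1, which `c * logb 2 n ≥ 1` absorbs; the lower bound is where `40 ≤ c`
  -- is used.
  have hup : (Δ n : ℝ) ≤ 2 * c * Real.logb 2 n := by nlinarith
  have hlow : 40 * Real.logb 2 n - 1 ≤ Δ n := by nlinarith
  refine ⟨h2, ?_, ?_, ?_, hup, ?_, h7⟩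
  · have : (Δ n * 2 ^ 40 : ℝ) ≤ n := by
      calc (Δ n * 2 ^ 40 : ℝ) ≤ 2 * c * (1 / (2 * c * 2 ^ 40) * n) * 2 ^ 40 := by
            gcongr
            exact hup.trans (by gcongr)
        _ = n := by field_simp
    exact_mod_cast this
  · have : (0 : ℝ) < Δ n := by linarith
    exact_mod_cast this
  · calc (n : ℝ) ^ 40 = 2 ^ (Real.logb 2 n * (40 : ℕ)) := by
          rw [Real.rpow_mul (by norm_num), Real.rpow_logb (by norm_num) (by norm_num) hn0,
            Real.rpow_natCast]
      _ ≤ 2 ^ ((1 : ℝ) + Δ n) := by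
          refine Real.rpow_le_rpow_of_exponent_le (by norm_num) ?_
          push_cast
          linarith
      _ = 2 * 2 ^ Δ n := by rw [Real.rpow_add (by norm_num), Real.rpow_one, Real.rpow_natCast]
  · linarith

end Estimates

/-! ### Probability of the bad events and the theorem -/

section Main

/-- The events excluded for a good formula and split. -/
def Bad {m n Δ : ℕ} (p : ℝ) (ω : Formula m n Δ × Finset (Fin n)) : Prop :=
  (¬ ω.1.Expands (n / (Δ * 2 ^ 40)) ∨ (2 : ℝ) ^ n / 2 ≤ ω.1.numSat) ∨
    p / 4 * 2 ^ Δ ≤ (ω.1.unbalanced ω.2).card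

theorem Regime.uniformProb_bad_le {a b c κ p : ℝ} {m n Δ : ℕ} (h : Regime c κ p n Δ) (hp : 0 < p)
    (ham : a * 2 ^ Δ * n ≤ m) (hmb : (m : ℝ) ≤ b * 2 ^ Δ * n) (hbn : b ≤ n) :
    uniformProb (Formula m n Δ × Finset (Fin n)) (Bad p) ≤
      2 / (n : ℝ) ^ 40 + 2 * Real.exp (-(a * n)) + 16 / (p * n) := by
  have hn8 : (8 : ℝ) ≤ n := by exact_mod_cast h.eight_le
  have hn0 : (0 : ℝ) < n := by linarith
  have hΔn : Δ ≤ n := by have := h.width_le; omega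
  have h2Δ : (0 : ℝ) < 2 ^ Δ := by positivity
  have hr1 : 1 ≤ n / (Δ * 2 ^ 40) :=
    Nat.div_pos h.width_le (by have := h.width_pos; positivity)
  have hr : n / (Δ * 2 ^ 40) * Δ * 2 ^ 40 ≤ n := by
    rw [mul_assoc]; exact Nat.div_mul_le_self _ _
  have e1 : uniformProb (Formula m n Δ × Finset (Fin n))
      (fun ω => ¬ ω.1.Expands (n / (Δ * 2 ^ 40))) ≤ 2 / (n : ℝ) ^ 40 := by
    rw [uniformProb_fst (Ω' := Finset (Fin n)) fun φ : Formula m n Δ =>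
      ¬ φ.Expands (n / (Δ * 2 ^ 40))]
    -- The union bound needs `m ≤ 4 ^ Δ`. Since `m ≤ b * 2 ^ Δ * n` and `b ≤ n`, this reduces to `n
    -- ^ 2 ≤ 2 ^ Δ`.
    have hm : (m : ℝ) ≤ 4 ^ Δ := by
      have h1 : b * n ≤ 2 ^ Δ := by
        have h2 : 2 * (n : ℝ) ^ 2 ≤ n ^ 40 := by
          calc 2 * (n : ℝ) ^ 2 ≤ (n : ℝ) * (n : ℝ) ^ 2 := by gcongr; linarith
            _ = (n : ℝ) ^ 3 := by ring
            _ ≤ (n : ℝ) ^ 40 := pow_le_pow_right₀ (by linarith) (by norm_num)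
        have := h.pow_le
        nlinarith
      calc (m : ℝ) ≤ 2 ^ Δ * (b * n) := by linarith
        _ ≤ 2 ^ Δ * 2 ^ Δ := by gcongr
        _ = 4 ^ Δ := by rw [← mul_pow]; norm_num
    refine (uniformProb_not_expands_le hΔn _ (by omega)).trans
      ((choose_mul_choose_mul_pow_le (by have := h.eight_le; omega) hm hr).trans ?_)
    calc (1 / 2 : ℝ) ^ (n / (Δ * 2 ^ 40) * Δ) ≤ (1 / 2) ^ Δ :=
          pow_le_pow_of_le_one (by norm_num) (by norm_num) (Nat.le_mul_of_pos_left _ hr1)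
      _ = 1 / 2 ^ Δ := by rw [div_pow, one_pow]
      _ ≤ 2 / (n : ℝ) ^ 40 := by
          rw [div_le_div_iff₀ h2Δ (by positivity)]
          have := h.pow_le
          linarith
  have e2 : uniformProb (Formula m n Δ × Finset (Fin n))
      (fun ω => (2 : ℝ) ^ n / 2 ≤ ω.1.numSat) ≤ 2 * Real.exp (-(a * n)) := by
    rw [uniformProb_fst (Ω' := Finset (Fin n)) fun φ : Formula m n Δ =>
      (2 : ℝ) ^ n / 2 ≤ φ.numSat]
    refine (uniformProb_le_numSat hΔn (by positivity)).trans ?_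
    have : a * n ≤ m / 2 ^ Δ := by rw [le_div_iff₀ h2Δ]; linarith
    calc 2 ^ n * Real.exp (-(m / 2 ^ Δ)) / (2 ^ n / 2)
        = 2 * Real.exp (-(m / 2 ^ Δ)) := by field_simp
      _ ≤ _ := by gcongr
  have e3 : uniformProb (Formula m n Δ × Finset (Fin n))
      (fun ω => p / 4 * 2 ^ Δ ≤ (ω.1.unbalanced ω.2).card) ≤ 16 / (p * n) := by
    refine (uniformProb_le_card_unbalanced (by positivity)).trans ?_
    -- The expected number of unbalanced clauses is at most `m * 4 / n ^ 4`, which is small compared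
    -- with `2 ^ Δ` because `m ≤ n ^ 2 * 2 ^ Δ`.
    have h9 := nine_tenths_pow_le (by have := h.eight_le; omega) h.pow_le
    rw [div_le_div_iff₀ (by positivity) (by positivity)]
    have h10 : (m : ℝ) ≤ n * 2 ^ Δ * n := hmb.trans (by gcongr)
    calc (m : ℝ) * (2 * (9 / 10) ^ Δ) * (p * n)
        ≤ (n * 2 ^ Δ * n) * (2 * (2 / n ^ 4)) * (p * n) := by gcongr
      _ = 4 * p * 2 ^ Δ / n := by field_simp; norm_num
      _ ≤ 4 * p * 2 ^ Δ := div_le_self (by positivity) (by linarith)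
      _ = 16 * (p / 4 * 2 ^ Δ) := by ring
  exact (uniformProb_or_le _ _).trans (add_le_add ((uniformProb_or_le _ _).trans
    (add_le_add e1 e2)) e3)

theorem tendsto_exp_neg_mul_nat {a : ℝ} (ha : 0 < a) :
    Tendsto (fun n : ℕ => Real.exp (-(a * n))) atTop (𝓝 0) :=
  Real.tendsto_exp_neg_atTop_nhds_zero.comp
    ((tendsto_natCast_atTop_atTop (R := ℝ)).const_mul_atTop ha)

theorem tendsto_bad_bound {a p : ℝ} (ha : 0 < a) :
    Tendsto (fun n : ℕ => 2 / (n : ℝ) ^ 40 + 2 * Real.exp (-(a * n)) + 16 / (p * n))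
      atTop (𝓝 0) := by
  have h1 : Tendsto (fun n : ℕ => 2 / (n : ℝ) ^ 40) atTop (𝓝 0) :=
    ((tendsto_pow_atTop (by norm_num)).comp
      (tendsto_natCast_atTop_atTop (R := ℝ))).const_div_atTop 2
  have h2 := (tendsto_exp_neg_mul_nat ha).const_mul 2
  have h3 : Tendsto (fun n : ℕ => 16 / (p * n)) atTop (𝓝 0) := by
    refine (tendsto_const_div_atTop_nhds_zero_nat (16 / p)).congr fun n => ?_
    rw [div_div]
  simpa using (h1.add h2).add h3

theorem Formula.unsat_of_numSat_lt_one {m n Δ : ℕ} {φ : Formula m n Δ} (h : φ.numSat < 1) :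
    φ.Unsat := by
  classical
  intro z
  by_contra! hz
  rw [Nat.lt_one_iff, Formula.numSat, card_eq_zero] at h
  exact filter_eq_empty_iff.1 h (mem_univ z) hz

end Main

end SearchCNF

open SearchCNF in
theorem mainTheorem1 (c a b p : ℝ) (hc : 40 ≤ c) (ha : 0 < a) (hp : 0 < p) :
    ∃ κ : ℝ, 0 < κ ∧
      ∀ Δ m : ℕ → ℕ,
        (∀ᶠ n : ℕ in atTop, |(Δ n : ℝ) - c * Real.logb 2 (n : ℝ)| ≤ 1) →
        (∀ᶠ n : ℕ in atTop, a * 2 ^ (Δ n) * (n : ℝ) ≤ (m n : ℝ) ∧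
          (m n : ℝ) ≤ b * 2 ^ (Δ n) * (n : ℝ)) →
        Tendsto (fun n : ℕ =>
            SearchCNF.uniformProb (SearchCNF.Formula (m n) n (Δ n) × Finset (Fin n))
              (fun ω => SearchCNF.RandCommAtLeast ω.1 ω.2 p (κ * n)))
          atTop (𝓝 1) ∧
        (Real.log 2 < a →
          Tendsto (fun n : ℕ =>
              SearchCNF.uniformProb (SearchCNF.Formula (m n) n (Δ n) × Finset (Fin n))
                (fun ω => ω.1.Unsat ∧ SearchCNF.RandCommAtLeast ω.1 ω.2 p (κ * n)))
            atTop (𝓝 1)) := by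
  have hκ : 0 < 1 / (8 * c * 2 ^ 40) := by positivity
  refine ⟨1 / (8 * c * 2 ^ 40), hκ, fun Δ m hΔ hm => ?_⟩
  have hreg := Regime.eventually hc hκ hp hΔ
  have hb : ∀ᶠ n : ℕ in atTop, b ≤ n := tendsto_natCast_atTop_atTop.eventually_ge_atTop b
  have hgood : ∀ {n : ℕ}, Regime c (1 / (8 * c * 2 ^ 40)) p n (Δ n) →
      ∀ ω : Formula (m n) n (Δ n) × Finset (Fin n), ¬ Bad p ω →
        RandCommAtLeast ω.1 ω.2 p (1 / (8 * c * 2 ^ 40) * n) := by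
    intro n h ω hω
    simp only [Bad, not_or, not_not, not_le] at hω
    exact h.randCommAtLeast hc rfl hp hω.1.1 (by linarith [hω.1.2]) hω.2.le
  have hnonempty : ∀ {n : ℕ}, Regime c (1 / (8 * c * 2 ^ 40)) p n (Δ n) →
      Nonempty (Formula (m n) n (Δ n) × Finset (Fin n)) := by
    intro n h
    have := nonempty_clause (n := n) (Δ := Δ n) (by have := h.width_le; omega)
    infer_instance
  have hbad := tendsto_bad_bound (p := p) ha
  constructor
  · have hlim := hbad.const_sub 1
    rw [sub_zero] at hlim
    refine tendsto_of_tendsto_of_tendsto_of_le_of_le' hlim tendsto_const_nhds ?_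
      (Eventually.of_forall fun n => uniformProb_le_one _)
    filter_upwards [hreg, hm, hb] with n h h1 h2
    have := hnonempty h
    have h3 := one_sub_le_uniformProb (hgood h)
    have h4 := h.uniformProb_bad_le hp h1.1 h1.2 h2
    linarith
  · intro hlog
    have hlim := (hbad.add (tendsto_exp_neg_mul_nat (sub_pos.2 hlog))).const_sub 1
    rw [add_zero, sub_zero] at hlim
    refine tendsto_of_tendsto_of_tendsto_of_le_of_le' hlim tendsto_const_nhds ?_
      (Eventually.of_forall fun n => uniformProb_le_one _)
    filter_upwards [hreg, hm, hb] with n h h1 h2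
    have := hnonempty h
    have hΔn : Δ n ≤ n := by have := h.width_le; omega
    have h3 := one_sub_le_uniformProb
      (E := fun ω : Formula (m n) n (Δ n) × Finset (Fin n) =>
        ω.1.Unsat ∧ RandCommAtLeast ω.1 ω.2 p (1 / (8 * c * 2 ^ 40) * n))
      (B := fun ω => Bad p ω ∨ (1 : ℝ) ≤ ω.1.numSat) (fun ω hω => by
        rw [not_or, not_le] at hω
        exact ⟨Formula.unsat_of_numSat_lt_one (by exact_mod_cast hω.2), hgood h ω hω.1⟩)
    have h4 := h.uniformProb_bad_le hp h1.1 h1.2 h2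
    have h5 := uniformProb_or_le (Bad p)
      fun ω : Formula (m n) n (Δ n) × Finset (Fin n) => (1 : ℝ) ≤ ω.1.numSat
    -- The expected number of satisfying assignments is at most `2 ^ n * exp (-(a * n))`, which
    -- decays exactly because `a > log 2`.
    have h6 : uniformProb (Formula (m n) n (Δ n) × Finset (Fin n))
        (fun ω => (1 : ℝ) ≤ ω.1.numSat) ≤ Real.exp (-((a - Real.log 2) * n)) := by
      rw [uniformProb_fst (Ω' := Finset (Fin n)) fun φ : Formula (m n) n (Δ n) =>
        (1 : ℝ) ≤ φ.numSat]
      refine (uniformProb_le_numSat hΔn one_pos).trans ?_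
      have h7 : a * n ≤ m n / 2 ^ Δ n := by
        rw [le_div_iff₀ (by positivity)]; linarith [h1.1]
      have h8 : (2 : ℝ) ^ n = Real.exp (n * Real.log 2) := by
        rw [Real.exp_nat_mul, Real.exp_log (by norm_num)]
      rw [div_one, h8, ← Real.exp_add, Real.exp_le_exp]
      linarith
    linarith
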